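/- All digraphs are finite, have at least one vertex, and have neither loops nor multiple arcs; a pair of opposite arcs $(u,v)$, $(v,u)$ is allowed. For a vertex $v$ of a digraph $D$ let $d^+(v)$ and $d^-(v)$ be its out-degree and in-degree; $D$ is \emph{$k$-diregular} if $d^+(v)=d^-(v)=k$ for every vertex $v$. A \emph{directed 2-factor} of $D$ is a spanning subdigraph of $D$ that is 1-diregular, i.e. a collection of vertex-disjoint directed cycles of $D$ (a pair of opposite arcs counts as a directed cycle of length $2$) that together cover all vertices of $D$. For a directed 2-factor $F$ and $i\in\{0,1\}$ let $t_i^*(F)$ be the number of cycles of $F$ whose length is congruent to $2i$ modulo $4$. A digraph $D$ is \emph{pseudo 2-factor isomorphic} if it has a directed 2-factor and the parity of the number of cycles is the same for all directed 2-factors of $D$. It is \emph{strongly pseudo 2-factor isomorphic} if it has a directed 2-factor and, for each $i\in\{0,1\}$, the parity of $t_i^*(F)$ is the same for all directed 2-factors $F$ of $D$. Then: (i) for every integer $k\ge 4$, no $k$-diregular digraph is pseudo 2-factor isomorphic, and no $k$-diregular digraph is strongly pseudo 2-factor isomorphic; (ii) every pseudo 2-factor isomorphic digraph on $n$ vertices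 has a vertex of out-degree at most $\lfloor \log_2 n\rfloor+1$. -/

import Mathlib

namespace Digraph

/-- The out-degree `d⁺(v)`: the number of vertices `w` with an arc `v → w`. -/
noncomputable def outDeg {V : Type*} (D : Digraph V) (v : V) : ℕ :=
  {w : V | D.Adj v w}.ncard

/-- The in-degree `d⁻(v)`: the number of vertices `u` with an arc `u → v`. -/
noncomputable def inDeg {V : Type*} (D : Digraph V) (v : V) : ℕ :=
  {u : V | D.Adj u v}.ncard

/-- `D` is `k`-diregular: every vertex has out-degree `k` and in-degree `k`. -/
def IsDiregular {V : Type*} (D : Digraph V) (k : ℕ) : Prop :=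
  ∀ v : V, D.outDeg v = k ∧ D.inDeg v = k

/-- `F` is a directed 2-factor of `D`: a spanning subdigraph of `D` in which every vertex has
exactly one out-going and one in-coming arc, that is, a family of vertex-disjoint directed cycles
of `D` covering all the vertices. -/
def IsTwoFactor {V : Type*} (D F : Digraph V) : Prop :=
  F ≤ D ∧ F.IsDiregular 1

/-- The (weakly) connected components of a digraph: the quotient of the vertex set by the
equivalence relation generated by adjacency. The components of a directed 2-factor of a finite
digraph are exactly its directed cycles. -/
abbrev Component {V : Type*} (F : Digraph V) : Type _ := Quot F.Adj

/-- The number of vertices of a component. For a component of a directed 2-factor this is the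
length of the corresponding directed cycle. -/
noncomputable def componentSize {V : Type*} (F : Digraph V) (C : F.Component) : ℕ :=
  {v : V | Quot.mk F.Adj v = C}.ncard

/-- The number of cycles of a directed 2-factor `F`. -/
noncomputable def numCycles {V : Type*} (F : Digraph V) : ℕ :=
  Nat.card F.Component

/-- `t*_i(F)`: the number of cycles of a directed 2-factor `F` whose length is congruent to `2 * i`
modulo `4`. -/
noncomputable def numCyclesMod {V : Type*} (F : Digraph V) (i : ℕ) : ℕ :=
  {C : F.Component | F.componentSize C ≡ 2 * i [MOD 4]}.ncard

/-- `D` is pseudo 2-factor isomorphic: it has a directed 2-factor, and the parity of the number of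
cycles is the same for all its directed 2-factors. -/
def IsPseudoTwoFactorIsomorphic {V : Type*} (D : Digraph V) : Prop :=
  (∃ F, D.IsTwoFactor F) ∧
    ∀ F F', D.IsTwoFactor F → D.IsTwoFactor F' → F.numCycles ≡ F'.numCycles [MOD 2]

/-- `D` is strongly pseudo 2-factor isomorphic: it has a directed 2-factor, and, for `i = 0, 1`,
the parity of the number of cycles of length congruent to `2 * i` modulo `4` is the same for all
its directed 2-factors. -/
def IsStronglyPseudoTwoFactorIsomorphic {V : Type*} (D : Digraph V) : Prop :=
  (∃ F, D.IsTwoFactor F) ∧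
    ∀ F F', D.IsTwoFactor F → D.IsTwoFactor F' →
      F.numCyclesMod 0 ≡ F'.numCyclesMod 0 [MOD 2] ∧ F.numCyclesMod 1 ≡ F'.numCyclesMod 1 [MOD 2]

end Digraph

/-! In a loopless digraph a directed 2-factor is a permutation supported on the arcs, and its sign
is determined by the order and the parity of the number of cycles. Hence pseudo 2-factor isomorphism
says that all nonzero terms of the determinant of the adjacency matrix have one sign. The matrix is
then sign-nonsingular (`Good`): every nonnegative reweighting that keeps a nonzero diagonal is
nonsingular. The strong property implies the weak one, because modulo two the number of cycles is
the order plus the number of even cycles.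

For (ii), if all out-degrees were larger, a count would give a two-colouring of the vertices in
which every out-neighbourhood meets both colours (`exists_bichromatic`). Reweighting each row so
that its two colours balance puts a vector of signs in the kernel.

For (i), the core is `ec_le_of_brace`: a sign-nonsingular brace of order `n` has at most `4 n - 4`
edges. A regular graph of degree at least four contains an elementary block with all degrees at
least four, and contracting along a smallest tight pair yields a brace with too many edges.

The bound is proved by induction. If every edge deletion leaves a brace, all columns have degree at
least four and deleting one edge gives a contradiction. Otherwise some edge `(u, t)` is the only one
between sets `X`, `Y` of total size `n - 1` (`Sep`). A bound on the edges at `X` is carried up a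
chain of such separations, the piece between consecutive ones being contracted to a smaller brace
(`Cov.ec_piece`). Edges crossing a separation are controlled by linear algebra: two-dimensional
kernels on either side turn the common sign of matchings into a comonotonicity condition, so away
from the ends of one crossing edge the others form a forest (`Cut.ec_add_one_le`). -/

namespace SignedBip

open Finset
open scoped Classical

variable {V : Type*}

/-! ### Matchings and sign-nonsingular matrices. -/

/-- The columns of `B` adjacent to a row of `W`. -/
noncomputable def nbr (M : V → V → ℝ) (B W : Finset V) : Finset V :=
  B.filter fun j => ∃ i ∈ W, M i j ≠ 0

/-- The number of edges between the rows `X` and the columns `Y`. -/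
noncomputable def ec (M : V → V → ℝ) (X Y : Finset V) : ℕ :=
  ((X ×ˢ Y).filter fun p => M p.1 p.2 ≠ 0).card

/-- The rows of `A` can be matched into the columns `B`. -/
def PM (A B : Finset V) (M : V → V → ℝ) : Prop :=
  ∃ f : V → V, Set.InjOn f A ∧ ∀ i ∈ A, f i ∈ B ∧ M i (f i) ≠ 0

/-- The signed bipartite graph `M` on rows `A` and columns `B` is sign-nonsingular. -/
def Good (A B : Finset V) (M : V → V → ℝ) : Prop :=
  ∀ w : V → V → ℝ, (∀ i j, 0 ≤ w i j) → PM A B (fun i j => w i j * M i j) →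
    ∀ x : V → ℝ, (∀ i ∈ A, ∑ j ∈ B, w i j * M i j * x j = 0) → ∀ j ∈ B, x j = 0

/-- Nonempty nonadjacent sets of rows and columns are together smaller than the order by two. -/
def Brace (A B : Finset V) (M : V → V → ℝ) : Prop :=
  ∀ P ⊆ A, ∀ L ⊆ B, P.Nonempty → L.Nonempty → (∀ i ∈ P, ∀ j ∈ L, M i j = 0) →
    P.card + L.card + 2 ≤ A.card

/-- The transposed matrix. -/
def tr (M : V → V → ℝ) : V → V → ℝ := fun i j => M j i

lemma mem_nbr {M : V → V → ℝ} {B W : Finset V} {j : V} :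
    j ∈ nbr M B W ↔ j ∈ B ∧ ∃ i ∈ W, M i j ≠ 0 := by
  simp [nbr]

lemma nbr_subset {M : V → V → ℝ} {B W : Finset V} : nbr M B W ⊆ B := filter_subset _ _

lemma PM_of_hall {A B : Finset V} {M : V → V → ℝ}
    (h : ∀ W ⊆ A, W.Nonempty → W.card ≤ (nbr M B W).card) : PM A B M := by
  have key := (Finset.all_card_le_biUnion_card_iff_exists_injective
    (fun i : A => B.filter fun j => M i j ≠ 0)).1 (by
      intro s
      rcases s.eq_empty_or_nonempty with rfl | hs
      · simp
      have h1 := h (s.map (Function.Embedding.subtype _))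
        (by intro x hx; simp only [mem_map] at hx; obtain ⟨a, _, rfl⟩ := hx; exact a.2)
        (by simpa using hs)
      rw [card_map] at h1
      refine h1.trans (card_le_card ?_)
      intro j hj
      obtain ⟨hjB, i, hi, hij⟩ := mem_nbr.1 hj
      simp only [mem_map] at hi
      obtain ⟨a, ha, rfl⟩ := hi
      exact mem_biUnion.2 ⟨a, ha, mem_filter.2 ⟨hjB, hij⟩⟩)
  obtain ⟨f, hf, hf'⟩ := key
  refine ⟨fun i => if h : i ∈ A then f ⟨i, h⟩ else i, ?_, ?_⟩
  · intro i hi j hj hij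
    simp only [mem_coe] at hi hj
    simp only [hi, hj, dif_pos] at hij
    simpa using hf hij
  · intro i hi
    have := mem_filter.1 (hf' ⟨i, hi⟩)
    simpa only [hi, dif_pos] using this

/-- The size condition makes the matching a bijection onto `B`, so it can be inverted. -/
lemma PM.transpose {A B : Finset V} {M : V → V → ℝ} (hAB : B.card ≤ A.card) (h : PM A B M) :
    PM B A (tr M) := by
  obtain ⟨f, hf, hf'⟩ := h
  have himg : A.image f = B := by
    apply eq_of_subset_of_card_le
    · intro j hj
      obtain ⟨i, hi, rfl⟩ := mem_image.1 hj
      exact (hf' i hi).1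
    · rw [card_image_of_injOn hf]; exact hAB
  have hex : ∀ j ∈ B, ∃ i ∈ A, f i = j := by
    intro j hj; rw [← himg] at hj; simpa using hj
  choose! g hg hg' using hex
  refine ⟨g, ?_, fun j hj => ⟨hg j hj, ?_⟩⟩
  · intro i hi j hj hij
    rw [← hg' i hi, ← hg' j hj, hij]
  · have := (hf' _ (hg j hj)).2
    rw [hg' j hj] at this
    exact this

lemma PM.union {A A' B B' : Finset V} {M : V → V → ℝ} (h : PM A B M) (h' : PM A' B' M)
    (hB : Disjoint B B') : PM (A ∪ A') (B ∪ B') M := by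
  obtain ⟨f, hf, hf'⟩ := h
  obtain ⟨g, hg, hg'⟩ := h'
  refine ⟨fun i => if i ∈ A then f i else g i, ?_, ?_⟩
  · intro i hi j hj hij
    simp only [coe_union, Set.mem_union, mem_coe] at hi hj
    by_cases h1 : i ∈ A <;> by_cases h2 : j ∈ A <;> simp only [h1, h2, if_true, if_false] at hij
    · exact hf h1 h2 hij
    · have h3 := (hf' i h1).1
      have h4 := (hg' j (hj.resolve_left h2)).1
      rw [hij] at h3
      exact absurd h4 (disjoint_left.1 hB h3)
    · have h3 := (hf' j h2).1
      have h4 := (hg' i (hi.resolve_left h1)).1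
      rw [← hij] at h3
      exact absurd h4 (disjoint_left.1 hB h3)
    · exact hg (hi.resolve_left h1) (hj.resolve_left h2) hij
  · intro i hi
    by_cases h1 : i ∈ A
    · simp only [h1, if_true, mem_union]
      exact ⟨Or.inl (hf' i h1).1, (hf' i h1).2⟩
    · simp only [h1, if_false, mem_union]
      have := hg' i ((mem_union.1 hi).resolve_left h1)
      exact ⟨Or.inr this.1, this.2⟩

lemma PM.congr {A B : Finset V} {M M' : V → V → ℝ} (h : PM A B M)
    (hM : ∀ i ∈ A, ∀ j ∈ B, M i j ≠ 0 → M' i j ≠ 0) : PM A B M' := by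
  obtain ⟨f, hf, hf'⟩ := h
  exact ⟨f, hf, fun i hi => ⟨(hf' i hi).1, hM i hi _ (hf' i hi).1 (hf' i hi).2⟩⟩

lemma PM.mono {A B B' : Finset V} {M : V → V → ℝ} (h : PM A B M) (hB : B ⊆ B') : PM A B' M := by
  obtain ⟨f, hf, hf'⟩ := h
  exact ⟨f, hf, fun i hi => ⟨hB (hf' i hi).1, (hf' i hi).2⟩⟩

lemma Good.surj {A B : Finset V} {M : V → V → ℝ} (hG : Good A B M) (hAB : A.card = B.card)
    {w : V → V → ℝ} (hw : ∀ i j, 0 ≤ w i j) (hPM : PM A B (fun i j => w i j * M i j))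
    (g : V → ℝ) : ∃ x : V → ℝ, ∀ i ∈ A, ∑ j ∈ B, w i j * M i j * x j = g i := by
  let N : Matrix A B ℝ := fun i j => w i j * M i j
  have hinj : Function.Injective N.mulVecLin := by
    rw [← LinearMap.ker_eq_bot, LinearMap.ker_eq_bot']
    intro y hy
    have := hG w hw hPM (fun j => if h : j ∈ B then y ⟨j, h⟩ else 0) (by
      intro i hi
      have h1 := congrFun hy ⟨i, hi⟩
      change ∑ j : B, w i j * M i j * y j = 0 at h1
      rw [← h1, ← Finset.sum_coe_sort B]
      apply Finset.sum_congr rfl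
      intro j _
      simp)
    ext j
    have h2 := this j j.2
    simpa using h2
  have hsurj := (LinearMap.injective_iff_surjective_of_finrank_eq_finrank
    (f := N.mulVecLin) (by simp [hAB])).1 hinj
  obtain ⟨y, hy⟩ := hsurj (fun i => g i)
  refine ⟨fun j => if h : j ∈ B then y ⟨j, h⟩ else 0, fun i hi => ?_⟩
  have h1 := congrFun hy ⟨i, hi⟩
  change ∑ j : B, w i j * M i j * y j = g i at h1
  rw [← h1, ← Finset.sum_coe_sort B]
  apply Finset.sum_congr rfl
  intro j _
  simp

/-- A kernel vector `y` of the transpose is orthogonal to the image of the matrix. By `Good.surj`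
the image contains `y` itself, so `y` has norm zero. -/
lemma Good.transpose {A B : Finset V} {M : V → V → ℝ} (hG : Good A B M) (hAB : A.card = B.card) :
    Good B A (tr M) := by
  intro w hw hPM y hy
  have hPM' : PM A B (fun i j => w j i * M i j) := hPM.transpose hAB.le
  obtain ⟨x, hx⟩ := hG.surj hAB (w := fun i j => w j i) (fun i j => hw j i) hPM' y
  have h0 : ∑ i ∈ A, y i * y i = 0 := by
    calc ∑ i ∈ A, y i * y i = ∑ i ∈ A, ∑ j ∈ B, w j i * M i j * x j * y i := by
          apply Finset.sum_congr rfl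
          intro i hi
          rw [← Finset.sum_mul, hx i hi]
      _ = ∑ j ∈ B, ∑ i ∈ A, w j i * M i j * x j * y i := Finset.sum_comm
      _ = ∑ j ∈ B, (∑ i ∈ A, w j i * tr M j i * y i) * x j := by
          apply Finset.sum_congr rfl
          intro j _
          rw [Finset.sum_mul]
          apply Finset.sum_congr rfl
          intro i _
          simp only [tr]; ring
      _ = 0 := by
          apply Finset.sum_eq_zero
          intro j hj
          rw [hy j hj, zero_mul]
  intro i hi
  have := (Finset.sum_eq_zero_iff_of_nonneg (fun i _ => mul_self_nonneg (y i))).1 h0 i hi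
  exact mul_self_eq_zero.1 this

/-! ### Contractions that preserve sign-nonsingularity. -/

/-- More unknowns than equations. -/
lemma exists_ne_zero_ker {I J : Finset V} (M : V → V → ℝ) (h : I.card < J.card) :
    ∃ y : V → ℝ, (∀ j, j ∉ J → y j = 0) ∧ (∃ j ∈ J, y j ≠ 0) ∧
      ∀ i ∈ I, ∑ j ∈ J, M i j * y j = 0 := by
  let N : Matrix I J ℝ := fun i j => M i j
  have : ∃ y, N.mulVec y = 0 ∧ y ≠ 0 := by
    by_contra! hc
    have hinj : Function.Injective N.mulVecLin := by
      rw [← LinearMap.ker_eq_bot, LinearMap.ker_eq_bot']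
      intro y hy
      exact hc y hy
    have := LinearMap.finrank_le_finrank_of_injective hinj
    simp at this
    omega
  obtain ⟨y, hy, hy0⟩ := this
  refine ⟨fun j => if h : j ∈ J then y ⟨j, h⟩ else 0, fun j hj => by simp [hj], ?_, ?_⟩
  · by_contra! hc
    apply hy0
    ext j
    have := hc j j.2
    simpa using this
  · intro i hi
    have h1 := congrFun hy ⟨i, hi⟩
    simp only [Matrix.mulVec, dotProduct, N, Pi.zero_apply] at h1
    rw [← h1, ← Finset.sum_coe_sort J]
    apply Finset.sum_congr rfl
    intro j _
    simp

/-- A vector without zeros whose products with every row take both signs. -/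
lemma exists_balanced {S T : Finset V} {M : V → V → ℝ}
    (hall : ∀ W ⊆ S, W.Nonempty → W.card + 1 ≤ (nbr M T W).card) :
    ∃ x : V → ℝ, (∀ j ∈ T, x j ≠ 0) ∧
      ∀ i ∈ S, (∃ j ∈ T, 0 < M i j * x j) ∧ ∃ j ∈ T, M i j * x j < 0 := by
  -- Rows annihilated entrywise are allowed, so the zero vector qualifies; a vector of largest
  -- support will turn out to have no zeros.
  let bal : (V → ℝ) → Prop := fun x => ∀ i ∈ S,
    ((∃ j ∈ T, 0 < M i j * x j) ∧ ∃ j ∈ T, M i j * x j < 0) ∨ ∀ j ∈ T, M i j * x j = 0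
  let P : Finset V → Prop := fun K => ∃ x, bal x ∧ T.filter (fun j => x j ≠ 0) = K
  have hP : ∃ K, K ∈ T.powerset.filter P := by
    refine ⟨∅, mem_filter.2 ⟨by simp, 0, ?_, by simp⟩⟩
    intro i _; right; simp
  obtain ⟨K, hK, hmax⟩ := exists_max_image (T.powerset.filter P) card hP
  obtain ⟨hKT, x, hx, hxK⟩ := mem_filter.1 hK
  set J := T.filter (fun j => x j = 0) with hJ
  set I := S.filter (fun i => ∀ j ∈ T, M i j ≠ 0 → j ∈ J) with hI
  have hnz : ∀ j ∈ T, x j ≠ 0 := by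
    by_contra! hc
    obtain ⟨j0, hj0, hxj0⟩ := hc
    -- The rows `I` meet only zeros of `x`. The surplus hypothesis makes them fewer than these
    -- zeros, so a kernel vector on `J` exists, and adding it enlarges the support.
    have hcard : I.card < J.card := by
      rcases I.eq_empty_or_nonempty with h | h
      · rw [h, card_empty]; exact card_pos.2 ⟨j0, mem_filter.2 ⟨hj0, hxj0⟩⟩
      · have h1 := hall I (filter_subset _ _) h
        have h2 : nbr M T I ⊆ J := by
          intro j hj
          obtain ⟨hjT, i, hi, hij⟩ := mem_nbr.1 hj
          exact (mem_filter.1 hi).2 j hjT hij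
        have := card_le_card h2
        omega
    obtain ⟨y, hy0, ⟨j1, hj1, hyj1⟩, hy⟩ := exists_ne_zero_ker M hcard
    have hJT : J ⊆ T := filter_subset _ _
    have hxJ : ∀ j ∈ J, x j = 0 := fun j hj => (mem_filter.1 hj).2
    have hxy : ∀ j, x j ≠ 0 → j ∈ T → y j = 0 := by
      intro j hj hjT
      apply hy0
      intro h
      exact hj (hxJ j h)
    have hbal : bal (fun j => x j + y j) := by
      intro i hi
      by_cases hiI : i ∈ I
      · have hiI' := (mem_filter.1 hiI).2
        have hsum : ∑ j ∈ J, M i j * y j = 0 := hy i hiI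
        by_cases hall0 : ∀ j ∈ J, M i j * y j = 0
        · right
          intro j hj
          by_cases hM : M i j = 0
          · simp [hM]
          · have hjJ := hiI' j hj hM
            rw [mul_add, hxJ j hjJ, hall0 j hjJ]; simp
        · left
          push Not at hall0
          obtain ⟨j2, hj2, hne⟩ := hall0
          have hpos : ∃ j ∈ J, 0 < M i j * y j := by
            by_contra! hc
            exact hne ((Finset.sum_eq_zero_iff_of_nonpos hc).1 hsum j2 hj2)
          have hneg : ∃ j ∈ J, M i j * y j < 0 := by
            by_contra! hc
            exact hne ((Finset.sum_eq_zero_iff_of_nonneg hc).1 hsum j2 hj2)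
          obtain ⟨a, ha, ha'⟩ := hpos
          obtain ⟨b, hb, hb'⟩ := hneg
          refine ⟨⟨a, hJT ha, ?_⟩, b, hJT hb, ?_⟩
          · simpa [hxJ a ha] using ha'
          · simpa [hxJ b hb] using hb'
      · rcases hx i hi with h | h
        · left
          obtain ⟨⟨a, ha, ha'⟩, b, hb, hb'⟩ := h
          refine ⟨⟨a, ha, ?_⟩, b, hb, ?_⟩
          · have : x a ≠ 0 := by rintro h; simp [h] at ha'
            simpa [hxy a this ha] using ha'
          · have : x b ≠ 0 := by rintro h; simp [h] at hb'
            simpa [hxy b this hb] using hb'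
        · exfalso
          apply hiI
          refine mem_filter.2 ⟨hi, fun j hj hM => mem_filter.2 ⟨hj, ?_⟩⟩
          exact (mul_eq_zero.1 (h j hj)).resolve_left hM
    have hle := hmax (T.filter (fun j => x j + y j ≠ 0))
      (mem_filter.2 ⟨mem_powerset.2 (filter_subset _ _), _, hbal, rfl⟩)
    have hlt : K.card < (T.filter (fun j => x j + y j ≠ 0)).card := by
      apply card_lt_card
      rw [← hxK]
      refine ⟨?_, fun h => ?_⟩
      · intro j hj
        obtain ⟨hjT, hj'⟩ := mem_filter.1 hj
        refine mem_filter.2 ⟨hjT, ?_⟩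
        rw [hxy j hj' hjT, add_zero]; exact hj'
      · have : j1 ∈ T.filter (fun j => x j + y j ≠ 0) := by
          refine mem_filter.2 ⟨hJT hj1, ?_⟩
          rw [hxJ j1 hj1, zero_add]; exact hyj1
        exact (mem_filter.1 (h this)).2 (hxJ j1 hj1)
    omega
  refine ⟨x, hnz, fun i hi => ?_⟩
  rcases hx i hi with h | h
  · exact h
  · exfalso
    have h1 := hall {i} (by simpa using hi) (by simp)
    have : (nbr M T {i}).Nonempty := by
      rw [← card_pos]; omega
    obtain ⟨j, hj⟩ := this
    obtain ⟨hjT, i', hi', hij⟩ := mem_nbr.1 hj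
    rw [mem_singleton] at hi'; subst hi'
    exact (mul_ne_zero hij (hnz j hjT)) (h j hjT)

/-- Contracting a set `T` of columns together with a set `S` of rows to the single column `t₀`. -/
lemma Good.collapse_cols {A B S T : Finset V} {M : V → V → ℝ} (hG : Good A B M)
    (hS : S ⊆ A) (hT : T ⊆ B) {t₀ : V} (ht₀ : t₀ ∈ T)
    (hall : ∀ W ⊆ S, W.Nonempty → W.card + 1 ≤ (nbr M T W).card) :
    ∃ M' : V → V → ℝ, Good (A \ S) (insert t₀ (B \ T)) M' ∧
      (∀ i j, j ≠ t₀ → M' i j = M i j) ∧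
      ∀ i, M' i t₀ ≠ 0 ↔ ∃ z ∈ T, M i z ≠ 0 := by
  obtain ⟨μ, hμ, hμS⟩ := exists_balanced hall
  have hz : ∀ i, ∃ z ∈ T, (∃ z ∈ T, M i z ≠ 0) → M i z ≠ 0 := by
    intro i
    by_cases h : ∃ z ∈ T, M i z ≠ 0
    · obtain ⟨z, hz, hz'⟩ := h
      exact ⟨z, hz, fun _ => hz'⟩
    · exact ⟨t₀, ht₀, fun h' => absurd h' h⟩
  choose z hzT hz using hz
  -- The new column stands for the vector `μ` on `T`. A row outside `S` is represented by one
  -- neighbour `z i` in `T`, since weights may erase the others.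
  refine ⟨fun i j => if j = t₀ then M i (z i) * μ (z i) else M i j, ?_, ?_, ?_⟩
  · intro w' hw' hPM' x' hx'
    have ht₀n : t₀ ∉ B \ T := by simp [ht₀]
    let p : V → ℝ := fun i => ∑ j ∈ T, max (M i j * μ j) 0
    let n : V → ℝ := fun i => ∑ j ∈ T, max (-(M i j * μ j)) 0
    have hp : ∀ i ∈ S, 0 < p i := by
      intro i hi
      obtain ⟨j, hj, hj'⟩ := (hμS i hi).1
      exact Finset.sum_pos' (fun j _ => le_max_right _ _) ⟨j, hj, lt_max_of_lt_left hj'⟩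
    have hn : ∀ i ∈ S, 0 < n i := by
      intro i hi
      obtain ⟨j, hj, hj'⟩ := (hμS i hi).2
      exact Finset.sum_pos' (fun j _ => le_max_right _ _)
        ⟨j, hj, lt_max_of_lt_left (neg_pos.2 hj')⟩
    have hp0 : ∀ i, 0 ≤ p i := fun i => Finset.sum_nonneg (fun j _ => le_max_right _ _)
    have hn0 : ∀ i, 0 ≤ n i := fun i => Finset.sum_nonneg (fun j _ => le_max_right _ _)
    -- In a row of `S` the positive products with `μ` total `p i` and the negative ones `-n i`. The
    -- crossed weights make the row annihilate `μ`.
    let w : V → V → ℝ := fun i j =>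
      if i ∈ S then (if j ∈ T then (if 0 < M i j * μ j then n i else p i) else 0)
      else if j ∈ T then (if j = z i then w' i t₀ else 0) else w' i j
    have hw : ∀ i j, 0 ≤ w i j := by
      intro i j
      simp only [w]
      split_ifs <;> first | exact hw' _ _ | exact hn0 _ | exact hp0 _ | exact le_rfl
    have hPM : PM A B (fun i j => w i j * M i j) := by
      obtain ⟨f, hf, hf'⟩ := hPM'
      -- `zs` is the column of `T` reserved for the row matched to `t₀`, if there is one; the
      -- surplus still lets `S` match into the rest of `T`.
      obtain ⟨zs, hzs, hzs'⟩ : ∃ zs ∈ T, ∀ i ∈ A \ S, f i = t₀ → z i = zs := by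
        by_cases h : ∃ i ∈ A \ S, f i = t₀
        · obtain ⟨i, hi, hi'⟩ := h
          refine ⟨z i, hzT i, fun k hk hk' => ?_⟩
          rw [hf (mem_coe.2 hk) (mem_coe.2 hi) (hk'.trans hi'.symm)]
        · exact ⟨t₀, ht₀, fun i hi hi' => absurd ⟨i, hi, hi'⟩ h⟩
      have h1 : PM S (T.erase zs) M := by
        apply PM_of_hall
        intro W hW hWn
        have h2 := hall W hW hWn
        have h3 : (nbr M T W).erase zs ⊆ nbr M (T.erase zs) W := by
          intro j hj
          obtain ⟨hj1, hj2⟩ := mem_erase.1 hj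
          obtain ⟨hj3, hj4⟩ := mem_nbr.1 hj2
          exact mem_nbr.2 ⟨mem_erase.2 ⟨hj1, hj3⟩, hj4⟩
        have h4 := card_le_card h3
        have h5 := pred_card_le_card_erase (s := nbr M T W) (a := zs)
        omega
      have h2 : PM S (T.erase zs) (fun i j => w i j * M i j) := by
        refine h1.congr (fun i hi j hj hij => ?_)
        have hjT := mem_of_mem_erase hj
        simp only [w, hi, hjT, if_true]
        refine mul_ne_zero ?_ hij
        split_ifs
        · exact (hn i hi).ne'
        · exact (hp i hi).ne'
      have h3 : PM (A \ S) (insert zs (B \ T)) (fun i j => w i j * M i j) := by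
        refine ⟨fun i => if f i = t₀ then zs else f i, ?_, ?_⟩
        · have hne : ∀ i ∈ A \ S, f i ≠ t₀ → f i ≠ zs := by
            intro i hi h h'
            have := (hf' i hi).1
            rcases mem_insert.1 this with h4 | h4
            · exact h h4
            · rw [h'] at h4; exact (mem_sdiff.1 h4).2 hzs
          intro i hi j hj hij
          have hi' := mem_coe.1 hi
          have hj' := mem_coe.1 hj
          dsimp only at hij
          split_ifs at hij with h4 h5 h5
          · exact hf hi hj (h4.trans h5.symm)
          · exact absurd hij.symm (hne j hj' h5)
          · exact absurd hij (hne i hi' h4)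
          · exact hf hi hj hij
        · intro i hi
          have hiS := (mem_sdiff.1 hi).2
          obtain ⟨h4, h5⟩ := hf' i hi
          dsimp only at h5 ⊢
          split_ifs with h6
          · refine ⟨mem_insert_self _ _, ?_⟩
            rw [h6] at h5
            simp only [if_true] at h5
            have h7 := hzs' i hi h6
            rw [← h7]
            simp only [w, hiS, hzT i, if_true, if_false]
            have h8 := left_ne_zero_of_mul h5
            have h9 := left_ne_zero_of_mul (right_ne_zero_of_mul h5)
            exact mul_ne_zero h8 h9
          · have h7 := (mem_insert.1 h4).resolve_left h6
            refine ⟨mem_insert_of_mem h7, ?_⟩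
            simp only [w, hiS, (mem_sdiff.1 h7).2, if_false]
            simpa only [h6, if_false] using h5
      have h4 := h2.union h3 (by
        rw [disjoint_left]
        intro j hj hj'
        rcases mem_insert.1 hj' with h | h
        · exact (mem_erase.1 hj).1 h
        · exact (mem_sdiff.1 h).2 (mem_of_mem_erase hj))
      rw [union_sdiff_of_subset hS] at h4
      refine h4.mono ?_
      intro j hj
      rcases mem_union.1 hj with h | h
      · exact hT (mem_of_mem_erase h)
      · rcases mem_insert.1 h with rfl | h
        · exact hT hzs
        · exact (mem_sdiff.1 h).1
    have hx := hG w hw hPM (fun j => if j ∈ T then μ j * x' t₀ else x' j) (by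
      intro i hi
      rw [← Finset.sum_sdiff hT]
      by_cases hiS : i ∈ S
      · have e1 : ∑ j ∈ B \ T, w i j * M i j * (if j ∈ T then μ j * x' t₀ else x' j) = 0 := by
          apply Finset.sum_eq_zero
          intro j hj
          simp [w, hiS, (mem_sdiff.1 hj).2]
        have e2 : ∑ j ∈ T, w i j * M i j * (if j ∈ T then μ j * x' t₀ else x' j)
            = ∑ j ∈ T, (n i * max (M i j * μ j) 0 - p i * max (-(M i j * μ j)) 0) * x' t₀ := by
          apply Finset.sum_congr rfl
          intro j hj
          simp only [w, hiS, hj, if_true]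
          split_ifs with h
          · rw [max_eq_left h.le, max_eq_right (by linarith)]; ring
          · push Not at h
            rw [max_eq_right h, max_eq_left (by linarith)]; ring
        rw [e1, e2, ← Finset.sum_mul, Finset.sum_sub_distrib, ← Finset.mul_sum, ← Finset.mul_sum]
        simp only [p, n]
        ring
      · have h1 := hx' i (mem_sdiff.2 ⟨hi, hiS⟩)
        rw [Finset.sum_insert ht₀n] at h1
        simp only [if_true] at h1
        rw [add_comm, ← h1]
        congr 1
        · rw [Finset.sum_eq_single (z i)]
          · simp only [w, hiS, hzT i, if_true, if_false]; ring
          · intro j hj hjz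
            simp [w, hiS, hj, hjz]
          · intro h; exact absurd (hzT i) h
        · apply Finset.sum_congr rfl
          intro j hj
          have h2 := (mem_sdiff.1 hj).2
          have h3 : j ≠ t₀ := by rintro rfl; exact h2 ht₀
          simp [w, hiS, h2, h3])
    intro j hj
    rcases mem_insert.1 hj with rfl | hj
    · have h1 := hx j (hT ht₀)
      simp only [ht₀, if_true] at h1
      exact (mul_eq_zero.1 h1).resolve_left (hμ j ht₀)
    · have h1 := hx j (mem_sdiff.1 hj).1
      simpa only [(mem_sdiff.1 hj).2, if_false] using h1
  · intro i j hj
    simp [hj]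
  · intro i
    simp only [if_true]
    constructor
    · intro h
      exact ⟨z i, hzT i, left_ne_zero_of_mul h⟩
    · intro h
      exact mul_ne_zero (hz i h) (hμ _ (hzT i))

/-- Contracting a set `P` of rows together with a set `L` of columns to the single row `r₀`. -/
lemma Good.collapse_rows {A B P L : Finset V} {M : V → V → ℝ} (hG : Good A B M)
    (hAB : A.card = B.card) (hP : P ⊆ A) (hL : L ⊆ B) (hPL : P.card = L.card + 1) {r₀ : V}
    (hr₀ : r₀ ∈ P)
    (hall : ∀ W ⊆ L, W.Nonempty → W.card + 1 ≤ (nbr (tr M) P W).card) :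
    ∃ M' : V → V → ℝ, Good (insert r₀ (A \ P)) (B \ L) M' ∧
      (∀ i j, i ≠ r₀ → M' i j = M i j) ∧
      ∀ j, M' r₀ j ≠ 0 ↔ ∃ y ∈ P, M y j ≠ 0 := by
  obtain ⟨M', h1, h2, h3⟩ := (hG.transpose hAB).collapse_cols hL hP hr₀ hall
  refine ⟨tr M', h1.transpose ?_, fun i j hi => h2 j i hi, fun j => h3 j⟩
  rw [card_insert_of_notMem (by simp [hr₀]), card_sdiff_of_subset hP, card_sdiff_of_subset hL]
  have := card_le_card hL
  have := card_le_card hP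
  omega

/-! ### Cuts and the signs of pairs of crossing edges. -/

/-- Rows `X ∪ R` and columns `T ∪ Q` with two more columns in `T` than rows in `X`, such that
`X` matches into `T` minus any two columns and `R` minus any two rows matches into `Q`. -/
structure Cut (X R T Q : Finset V) (M : V → V → ℝ) : Prop where
  good : Good (X ∪ R) (T ∪ Q) M
  disj_rows : Disjoint X R
  disj_cols : Disjoint T Q
  card_cols : T.card = X.card + 2
  card_rows : R.card = Q.card + 2
  pm_left : ∀ z ∈ T, ∀ z' ∈ T, z ≠ z' → PM X (T \ {z, z'}) M
  pm_right : ∀ y ∈ R, ∀ y' ∈ R, y ≠ y' → PM (R \ {y, y'}) Q M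

/-- The edges `(y, z)` and `(y', z')` are disjoint, with rows in `R` and columns in `T`. -/
def DisjEdges (R T : Finset V) (M : V → V → ℝ) (y z y' z' : V) : Prop :=
  y ∈ R ∧ z ∈ T ∧ y' ∈ R ∧ z' ∈ T ∧ y ≠ y' ∧ z ≠ z' ∧ M y z ≠ 0 ∧ M y' z' ≠ 0

/-- Every vector in the kernel of the rows `X` on the columns `T` is a combination of `p`, `q`. -/
def Spans (X T : Finset V) (M : V → V → ℝ) (p q : V → ℝ) : Prop :=
  ∀ x : V → ℝ, (∀ i ∈ X, ∑ j ∈ T, M i j * x j = 0) → ∃ c d, ∀ j ∈ T, x j = c * p j + d * q j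

lemma PM.pair {M : V → V → ℝ} {y z y' z' : V} (hy : y ≠ y') (hz : z ≠ z') (h : M y z ≠ 0)
    (h' : M y' z' ≠ 0) : PM {y, y'} {z, z'} M := by
  refine ⟨fun i => if i = y then z else z', ?_, ?_⟩
  · intro i hi j hj hij
    simp only [coe_insert, coe_singleton, Set.mem_insert_iff, Set.mem_singleton_iff] at hi hj
    rcases hi with rfl | rfl <;> rcases hj with rfl | rfl <;>
      simp [hy.symm, hz, hz.symm] at hij ⊢
  · intro i hi
    simp only [mem_insert, mem_singleton] at hi
    rcases hi with rfl | rfl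
    · simp [h]
    · simp [hy.symm, h']

/-- Two disjoint crossing edges extend to a perfect matching by the two matching conditions. So
giving crossing edges the weights `f` and erasing the block `X × Q` leaves a nonsingular matrix. -/
lemma Cut.solve {X R T Q : Finset V} {M : V → V → ℝ} (h : Cut X R T Q M) {y z y' z' : V}
    (he : DisjEdges R T M y z y' z') {f : V → V → ℝ} (hf : ∀ i j, 0 ≤ f i j)
    (hyz : f y z ≠ 0) (hyz' : f y' z' ≠ 0) (g : V → ℝ) :
    ∃ x : V → ℝ, (∀ i ∈ X, ∑ j ∈ T, M i j * x j = g i) ∧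
      ∀ i ∈ R, ∑ j ∈ T, f i j * M i j * x j + ∑ j ∈ Q, M i j * x j = g i := by
  obtain ⟨hy, hz, hy', hz', hne, hne', hM, hM'⟩ := he
  let w : V → V → ℝ := fun i j =>
    if i ∈ X then (if j ∈ T then 1 else 0) else (if j ∈ T then f i j else 1)
  have hw : ∀ i j, 0 ≤ w i j := by
    intro i j
    simp only [w]
    split_ifs <;> first | exact hf _ _ | norm_num
  have hRX : ∀ i ∈ R, i ∉ X := fun i hi hi' => disjoint_left.1 h.disj_rows hi' hi
  have hQT : ∀ i ∈ Q, i ∉ T := fun i hi hi' => disjoint_left.1 h.disj_cols hi' hi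
  have hzz : ({z, z'} : Finset V) ⊆ T := by
    intro a ha; simp only [mem_insert, mem_singleton] at ha; rcases ha with rfl | rfl <;> assumption
  have hyy : ({y, y'} : Finset V) ⊆ R := by
    intro a ha; simp only [mem_insert, mem_singleton] at ha; rcases ha with rfl | rfl <;> assumption
  have h1 : PM X (T \ {z, z'}) (fun i j => w i j * M i j) :=
    (h.pm_left z hz z' hz' hne').congr fun i hi j hj hij => by
      simpa [w, hi, (mem_sdiff.1 hj).1] using hij
  have h2 : PM (R \ {y, y'}) Q (fun i j => w i j * M i j) :=
    (h.pm_right y hy y' hy' hne).congr fun i hi j hj hij => by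
      simpa [w, hRX i (mem_sdiff.1 hi).1, hQT j hj] using hij
  have h3 : PM {y, y'} {z, z'} (fun i j => w i j * M i j) := by
    apply PM.pair hne hne'
    · simpa [w, hRX y hy, hz, hM] using hyz
    · simpa [w, hRX y' hy', hz', hM'] using hyz'
  have h4 := h1.union (h2.union h3 (by
    rw [disjoint_left]; intro a ha ha'; exact hQT a ha (hzz ha'))) (by
    rw [disjoint_left]
    intro a ha ha'
    obtain ⟨ha1, ha2⟩ := mem_sdiff.1 ha
    rcases mem_union.1 ha' with h5 | h5
    · exact hQT a h5 ha1
    · exact ha2 h5)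
  rw [sdiff_union_of_subset hyy] at h4
  have h5 : PM (X ∪ R) (T ∪ Q) (fun i j => w i j * M i j) := by
    refine h4.mono ?_
    intro a ha
    simp only [mem_union, mem_sdiff] at ha ⊢
    rcases ha with ha | ha | ha
    · exact Or.inl ha.1
    · exact Or.inr ha
    · exact Or.inl (hzz ha)
  have hcard : (X ∪ R).card = (T ∪ Q).card := by
    rw [card_union_of_disjoint h.disj_rows, card_union_of_disjoint h.disj_cols, h.card_cols,
      h.card_rows]
    omega
  obtain ⟨x, hx⟩ := h.good.surj hcard hw h5 g
  refine ⟨x, fun i hi => ?_, fun i hi => ?_⟩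
  · rw [← hx i (mem_union_left _ hi), sum_union h.disj_cols]
    have e : ∑ j ∈ Q, w i j * M i j * x j = 0 :=
      Finset.sum_eq_zero fun j hj => by simp [w, hi, hQT j hj]
    rw [e, add_zero]
    exact Finset.sum_congr rfl fun j hj => by simp [w, hi, hj]
  · rw [← hx i (mem_union_right _ hi), sum_union h.disj_cols]
    congr 1
    · exact Finset.sum_congr rfl fun j hj => by simp [w, hRX i hi, hj]
    · exact Finset.sum_congr rfl fun j hj => by simp [w, hRX i hi, hQT j hj]

/-- By `Cut.solve` the rows `X` have full rank on `T`, so their kernel has dimension `T.card -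
X.card = 2`. The normalisation at `t` serves the ratio `q / p` used later. -/
lemma Cut.exists_spans {X R T Q : Finset V} {M : V → V → ℝ} (h : Cut X R T Q M) {y z y' z' : V}
    (he : DisjEdges R T M y z y' z') {t : V} (ht : t ∈ T) :
    ∃ p q : V → ℝ, Spans X T M p q ∧ p t = 0 := by
  obtain ⟨p, hp0, ⟨z0, hz0, hpz⟩, hp⟩ := exists_ne_zero_ker (I := X) (J := T.erase t) M (by
    rw [card_erase_of_mem ht, h.card_cols]; omega)
  have hz0T := mem_of_mem_erase hz0
  obtain ⟨q, hq0, ⟨z1, hz1, hqz⟩, hq⟩ := exists_ne_zero_ker (I := X) (J := T.erase z0) M (by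
    rw [card_erase_of_mem hz0T, h.card_cols]; omega)
  have hz1T := mem_of_mem_erase hz1
  have hpt : p t = 0 := hp0 t (by simp)
  have hqz0 : q z0 = 0 := hq0 z0 (by simp)
  have hp' : ∀ i ∈ X, ∑ j ∈ T, M i j * p j = 0 := by
    intro i hi
    rw [← Finset.sum_erase T (a := t) (by simp [hpt])]
    exact hp i hi
  have hq' : ∀ i ∈ X, ∑ j ∈ T, M i j * q j = 0 := by
    intro i hi
    rw [← Finset.sum_erase T (a := z0) (by simp [hqz0])]
    exact hq i hi
  -- The values of `p`, `q` at `z0`, `z1` are triangular, since `q z0 = 0`. Any vector can be made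
  -- to vanish at both columns, which leaves a square system.
  have red : ∀ x : V → ℝ, ∃ c d, x z0 - (c * p z0 + d * q z0) = 0 ∧
      x z1 - (c * p z1 + d * q z1) = 0 := by
    intro x
    refine ⟨x z0 / p z0, (x z1 - x z0 / p z0 * p z1) / q z1, ?_, ?_⟩
    · rw [hqz0]; field_simp; ring
    · field_simp; ring
  have hlin : ∀ (x : V → ℝ) (c d : ℝ), ∀ i ∈ X,
      ∑ j ∈ T, M i j * (x j - (c * p j + d * q j)) = ∑ j ∈ T, M i j * x j := by
    intro x c d i hi
    have : ∑ j ∈ T, M i j * (x j - (c * p j + d * q j)) = ∑ j ∈ T, M i j * x j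
        - (c * ∑ j ∈ T, M i j * p j + d * ∑ j ∈ T, M i j * q j) := by
      rw [Finset.mul_sum, Finset.mul_sum, ← Finset.sum_add_distrib, ← Finset.sum_sub_distrib]
      exact Finset.sum_congr rfl fun j _ => by ring
    rw [this, hp' i hi, hq' i hi]; ring
  set J := (T.erase z0).erase z1 with hJ
  have hJT : J ⊆ T := (erase_subset _ _).trans (erase_subset _ _)
  have hsumJ : ∀ x : V → ℝ, x z0 = 0 → x z1 = 0 → ∀ i,
      ∑ j ∈ J, M i j * x j = ∑ j ∈ T, M i j * x j := by
    intro x h0 h1 i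
    rw [hJ, Finset.sum_erase _ (by simp [h1]), Finset.sum_erase _ (by simp [h0])]
  have hcard : X.card = J.card := by
    rw [hJ, card_erase_of_mem hz1, card_erase_of_mem hz0T, h.card_cols]; rfl
  let N : Matrix X J ℝ := fun i j => M i j
  have hsurj : Function.Surjective N.mulVecLin := by
    intro g
    obtain ⟨x, hx, -⟩ := h.solve he (f := fun _ _ => 1) (fun _ _ => zero_le_one) one_ne_zero
      one_ne_zero (fun i => if hi : i ∈ X then g ⟨i, hi⟩ else 0)
    obtain ⟨c, d, h0, h1⟩ := red x
    refine ⟨fun j => x j - (c * p j + d * q j), ?_⟩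
    ext i
    have h2 := hsumJ (fun j => x j - (c * p j + d * q j)) h0 h1 i
    rw [hlin x c d i i.2, hx i i.2, ← Finset.sum_coe_sort J] at h2
    simp only [i.2, dif_pos] at h2
    exact h2
  have hinj := (LinearMap.injective_iff_surjective_of_finrank_eq_finrank
    (f := N.mulVecLin) (by simp [hcard])).2 hsurj
  refine ⟨p, q, fun x hx => ?_, hpt⟩
  obtain ⟨c, d, h0, h1⟩ := red x
  refine ⟨c, d, fun j hj => ?_⟩
  have hk : N.mulVecLin (fun j => x j - (c * p j + d * q j)) = N.mulVecLin 0 := by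
    ext i
    have h2 := hsumJ (fun j => x j - (c * p j + d * q j)) h0 h1 i
    rw [hlin x c d i i.2, hx i i.2, ← Finset.sum_coe_sort J] at h2
    rw [map_zero]
    exact h2
  have hk' := hinj hk
  by_cases hjJ : j ∈ J
  · have := congrFun hk' ⟨j, hjJ⟩
    simp only [Pi.zero_apply] at this
    linarith
  · have : j = z1 ∨ j = z0 := by
      by_contra! hc
      exact hjJ (mem_erase.2 ⟨hc.1, mem_erase.2 ⟨hc.2, hj⟩⟩)
    rcases this with rfl | rfl
    · linarith
    · linarith

/-- The sign of a pair of edges. -/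
def theta (M : V → V → ℝ) (p q k l : V → ℝ) (y z y' z' : V) : ℝ :=
  M y z * M y' z' * (p z * q z' - p z' * q z) * (k y * l y' - k y' * l y)

/-- Compress the crossing block to a two by two matrix, using `p`, `q` for columns and a left kernel
pair `k`, `l` of `Q` for rows. For weights carried by two disjoint edges its determinant is `theta`.
It never vanishes on the segment between two such weights, so its sign is constant. -/
lemma Cut.exists_theta {X R T Q : Finset V} {M : V → V → ℝ} (h : Cut X R T Q M) {p q : V → ℝ}
    (hpq : Spans X T M p q) :
    ∃ k l : V → ℝ, ∀ y z y' z' u v u' v', DisjEdges R T M y z y' z' → DisjEdges R T M u v u' v' →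
      0 < theta M p q k l y z y' z' * theta M p q k l u v u' v' := by
  obtain ⟨k, -, ⟨y0, hy0, hky⟩, hk⟩ := exists_ne_zero_ker (I := Q) (J := R) (tr M) (by
    rw [h.card_rows]; omega)
  obtain ⟨l, hl0, ⟨y1, hy1, hly⟩, hl⟩ := exists_ne_zero_ker (I := Q) (J := R.erase y0) (tr M) (by
    rw [card_erase_of_mem hy0, h.card_rows]; omega)
  have hly0 : l y0 = 0 := hl0 y0 (by simp)
  have hl' : ∀ j ∈ Q, ∑ i ∈ R, tr M j i * l i = 0 := by
    intro i hi
    rw [← Finset.sum_erase R (a := y0) (by simp [hly0])]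
    exact hl i hi
  refine ⟨k, l, ?_⟩
  let n : (V → V → ℝ) → (V → ℝ) → (V → ℝ) → ℝ := fun f a b =>
    ∑ i ∈ R, ∑ j ∈ T, f i j * M i j * a i * b j
  have hn : ∀ f : V → V → ℝ, (∀ i j, 0 ≤ f i j) → (∃ y z y' z', DisjEdges R T M y z y' z' ∧
      f y z ≠ 0 ∧ f y' z' ≠ 0) → n f k p * n f l q - n f k q * n f l p ≠ 0 := by
    intro f hf ⟨y, z, y', z', he, hfy, hfy'⟩ hdet
    -- a nontrivial left kernel vector of the two by two matrix
    obtain ⟨γ, δ, hne, hγp, hγq⟩ : ∃ γ δ : ℝ, (γ ≠ 0 ∨ δ ≠ 0) ∧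
        γ * n f k p + δ * n f l p = 0 ∧ γ * n f k q + δ * n f l q = 0 := by
      by_cases h1 : n f l p = 0 ∧ n f k p = 0
      · by_cases h2 : n f l q = 0 ∧ n f k q = 0
        · exact ⟨1, 0, Or.inl one_ne_zero, by simp [h1.2], by simp [h2.2]⟩
        · refine ⟨n f l q, -n f k q, ?_, by rw [h1.1, h1.2]; ring, by ring⟩
          by_contra! hc
          exact h2 ⟨hc.1, neg_eq_zero.1 hc.2⟩
      · refine ⟨n f l p, -n f k p, ?_, by ring, by linarith⟩
        by_contra! hc
        exact h1 ⟨hc.1, neg_eq_zero.1 hc.2⟩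
    -- The right-hand side is the combination itself. Pairing it with the equations kills the part
    -- from `Q` (left kernel) and from `T` (choice of `γ`, `δ`), so its sum of squares over `R` is
    -- zero.
    let g : V → ℝ := fun i => if i ∈ X then 0 else γ * k i + δ * l i
    have hg : ∀ i ∈ R, g i = γ * k i + δ * l i := by
      intro i hi
      have : i ∉ X := fun hi' => disjoint_left.1 h.disj_rows hi' hi
      simp [g, this]
    obtain ⟨x, hx, hx'⟩ := h.solve he hf hfy hfy' g
    obtain ⟨c, d, hcd⟩ := hpq x (fun i hi => by rw [hx i hi]; simp [g, hi])
    have hQ : ∑ i ∈ R, (γ * k i + δ * l i) * ∑ j ∈ Q, M i j * x j = 0 := by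
      calc ∑ i ∈ R, (γ * k i + δ * l i) * ∑ j ∈ Q, M i j * x j
          = ∑ i ∈ R, ∑ j ∈ Q, (γ * k i + δ * l i) * (M i j * x j) := by simp_rw [Finset.mul_sum]
        _ = ∑ j ∈ Q, ∑ i ∈ R, (γ * k i + δ * l i) * (M i j * x j) := Finset.sum_comm
        _ = ∑ j ∈ Q, x j * (γ * ∑ i ∈ R, tr M j i * k i + δ * ∑ i ∈ R, tr M j i * l i) := by
            refine Finset.sum_congr rfl fun j _ => ?_
            rw [Finset.mul_sum, Finset.mul_sum, ← Finset.sum_add_distrib, Finset.mul_sum]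
            exact Finset.sum_congr rfl fun i _ => by simp only [tr]; ring
        _ = 0 := Finset.sum_eq_zero fun j hj => by rw [hk j hj, hl' j hj]; ring
    have hT : ∑ i ∈ R, (γ * k i + δ * l i) * ∑ j ∈ T, f i j * M i j * x j = 0 := by
      calc ∑ i ∈ R, (γ * k i + δ * l i) * ∑ j ∈ T, f i j * M i j * x j
          = c * (γ * n f k p + δ * n f l p) + d * (γ * n f k q + δ * n f l q) := by
            simp only [n, Finset.mul_sum, ← Finset.sum_add_distrib]
            refine Finset.sum_congr rfl fun i _ => Finset.sum_congr rfl fun j hj => ?_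
            rw [hcd j hj]; ring
        _ = 0 := by rw [hγp, hγq]; ring
    have hsq : ∑ i ∈ R, (γ * k i + δ * l i) * (γ * k i + δ * l i) = 0 := by
      have h0 := congrArg₂ (· + ·) hT hQ
      simp only [add_zero] at h0
      rw [← h0, ← Finset.sum_add_distrib]
      refine Finset.sum_congr rfl fun i hi => ?_
      rw [← mul_add, hx' i hi, hg i hi]
    have hz : ∀ i ∈ R, γ * k i + δ * l i = 0 := fun i hi =>
      mul_self_eq_zero.1 ((Finset.sum_eq_zero_iff_of_nonneg
        (fun i _ => mul_self_nonneg (γ * k i + δ * l i))).1 hsq i hi)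
    have hγ : γ = 0 := by
      have := hz y0 hy0
      rw [hly0, mul_zero, add_zero] at this
      exact (mul_eq_zero.1 this).resolve_right hky
    have hδ : δ = 0 := by
      have := hz y1 (mem_of_mem_erase hy1)
      rw [hγ, zero_mul, zero_add] at this
      exact (mul_eq_zero.1 this).resolve_right hly
    rcases hne with h1 | h1
    · exact h1 hγ
    · exact h1 hδ
  intro y z y' z' u v u' v' he he'
  let e : V → V → V → V → ℝ := fun a b i j => if i = a ∧ j = b then 1 else 0
  have he0 : ∀ a b i j, 0 ≤ e a b i j := by
    intro a b i j; simp only [e]; split_ifs <;> norm_num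
  -- At each point of this segment at least one of the two disjoint pairs keeps nonzero weight.
  let F : ℝ → V → V → ℝ := fun s i j =>
    (1 - s) * (e y z i j + e y' z' i j) + s * (e u v i j + e u' v' i j)
  have hne : ∀ a ∈ R, ∀ b ∈ T, ∀ α β : V → ℝ, ∑ i ∈ R, ∑ j ∈ T, e a b i j * M i j * α i * β j
      = M a b * α a * β b := by
    intro a ha b hb α β
    rw [Finset.sum_eq_single_of_mem a ha, Finset.sum_eq_single_of_mem b hb]
    · simp [e]
    · intro j _ hj; simp [e, hj]
    · intro i _ hi; simp [e, hi]
  have hnF : ∀ s α β, n (F s) α β = (1 - s) * (M y z * α y * β z + M y' z' * α y' * β z')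
      + s * (M u v * α u * β v + M u' v' * α u' * β v') := by
    intro s α β
    rw [← hne y he.1 z he.2.1, ← hne y' he.2.2.1 z' he.2.2.2.1, ← hne u he'.1 v he'.2.1,
      ← hne u' he'.2.2.1 v' he'.2.2.2.1]
    simp only [n, F, mul_add, Finset.mul_sum, ← Finset.sum_add_distrib]
    refine Finset.sum_congr rfl fun i _ => Finset.sum_congr rfl fun j hj => ?_
    ring
  let D : ℝ → ℝ := fun s => n (F s) k p * n (F s) l q - n (F s) k q * n (F s) l p
  have hD0 : D 0 = theta M p q k l y z y' z' := by
    simp only [D, hnF, theta]; ring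
  have hD1 : D 1 = theta M p q k l u v u' v' := by
    simp only [D, hnF, theta]; ring
  have hcont : Continuous D := by
    simp only [D, hnF]; fun_prop
  have hnz : ∀ s ∈ Set.Icc (0 : ℝ) 1, D s ≠ 0 := by
    intro s hs
    refine hn (F s) ?_ ?_
    · intro i j
      have h1 := he0 y z i j
      have h2 := he0 y' z' i j
      have h3 := he0 u v i j
      have h4 := he0 u' v' i j
      have h5 : 0 ≤ 1 - s := by linarith [hs.2]
      have := hs.1
      simp only [F]; positivity
    · rcases eq_or_ne s 1 with rfl | hs1
      · refine ⟨u, v, u', v', he', ?_, ?_⟩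
        · have h3 := he0 u' v' u v
          have h4 : e u v u v = 1 := by simp [e]
          simp only [F]; rw [h4]; intro h; linarith
        · have h3 := he0 u v u' v'
          have h4 : e u' v' u' v' = 1 := by simp [e]
          simp only [F]; rw [h4]; intro h; linarith
      · have h5 : 0 < 1 - s := sub_pos.2 (lt_of_le_of_ne hs.2 hs1)
        have h6 := hs.1
        refine ⟨y, z, y', z', he, ?_, ?_⟩
        · have h3 := he0 y' z' y z
          have h4 : e y z y z = 1 := by simp [e]
          have h7 := he0 u v y z
          have h8 := he0 u' v' y z
          simp only [F]; rw [h4]; positivity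
        · have h3 := he0 y z y' z'
          have h4 : e y' z' y' z' = 1 := by simp [e]
          have h7 := he0 u v y' z'
          have h8 := he0 u' v' y' z'
          simp only [F]; rw [h4]; positivity
  rw [← hD0, ← hD1]
  by_contra! hc
  have h0 := hnz 0 (by simp)
  have h1 := hnz 1 (by simp)
  have hex : ∃ s ∈ Set.Icc (0 : ℝ) 1, D s = 0 := by
    rcases lt_or_gt_of_ne h0 with h2 | h2
    · have h3 : 0 < D 1 := by
        by_contra! h4
        have := mul_pos_of_neg_of_neg h2 (lt_of_le_of_ne h4 h1)
        linarith
      exact intermediate_value_Icc zero_le_one hcont.continuousOn ⟨h2.le, h3.le⟩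
    · have h3 : D 1 < 0 := by
        by_contra! h4
        have := mul_pos h2 (lt_of_le_of_ne h4 h1.symm)
        linarith
      exact intermediate_value_Icc' zero_le_one hcont.continuousOn ⟨h3.le, h2.le⟩
  obtain ⟨s, hs, hs'⟩ := hex
  exact hnz s hs hs'

/-- A row of `R` has at most two neighbours in `T` that have further neighbours in `R`. -/
lemma Cut.row_branch {X R T Q : Finset V} {M : V → V → ℝ} (h : Cut X R T Q M) {y : V} (hy : y ∈ R)
    {z y' : Fin 3 → V} (hz : ∀ i, z i ∈ T) (hinj : ∀ i j, i ≠ j → z i ≠ z j)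
    (hM : ∀ i, M y (z i) ≠ 0) (hy' : ∀ i, y' i ∈ R) (hne : ∀ i, y ≠ y' i)
    (hM' : ∀ i, M (y' i) (z i) ≠ 0) : False := by
  have he : ∀ i j, i ≠ j → DisjEdges R T M y (z i) (y' j) (z j) := fun i j hij =>
    ⟨hy, hz i, hy' j, hz j, hne j, hinj i j hij, hM i, hM' j⟩
  obtain ⟨p, q, hpq, -⟩ := h.exists_spans (he 0 1 (by decide)) (hz 0)
  obtain ⟨k, l, hkl⟩ := h.exists_theta hpq
  -- Exchanging `z i` and `z j` reverses the factor of `theta` in `p`, `q`. Constancy of the sign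
  -- then forces `s i`, `s j` to have opposite signs, impossible for three reals.
  let s : Fin 3 → ℝ := fun i => M y (z i) * (M (y' i) (z i) * (k y * l (y' i) - k (y' i) * l y))
  have hs : ∀ i j, i ≠ j → s i * s j < 0 := by
    intro i j hij
    have h1 := hkl _ _ _ _ _ _ _ _ (he i j hij) (he j i hij.symm)
    have h2 : theta M p q k l y (z i) (y' j) (z j) * theta M p q k l y (z j) (y' i) (z i)
        = -(s i * s j) * (p (z i) * q (z j) - p (z j) * q (z i)) ^ 2 := by
      simp only [theta, s]; ring
    rw [h2] at h1
    have := pos_of_mul_pos_left h1 (sq_nonneg _)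
    linarith
  have h1 := hs 0 1 (by decide)
  have h2 := hs 1 2 (by decide)
  have h3 := hs 0 2 (by decide)
  have h4 := mul_pos_of_neg_of_neg h1 h2
  have h5 : s 0 * s 1 * (s 1 * s 2) = s 0 * s 2 * (s 1) ^ 2 := by ring
  rw [h5] at h4
  have := pos_of_mul_pos_left h4 (sq_nonneg _)
  linarith

/-- The ratio `q / p` on columns away from a fixed edge `(v, t)` is strictly comonotone with some
function of the rows. -/
lemma Cut.exists_comonotone {X R T Q : Finset V} {M : V → V → ℝ} (h : Cut X R T Q M)
    {p q : V → ℝ} (hpq : Spans X T M p q) {v t : V} (ht : t ∈ T) (hv : v ∈ R) (hpt : p t = 0)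
    (hvt : M v t ≠ 0) :
    ∃ b : V → ℝ, ∀ y z y' z', DisjEdges (R.erase v) (T.erase t) M y z y' z' →
      0 < (q z' / p z' - q z / p z) * (b y' - b y) := by
  obtain ⟨k, l, hkl⟩ := h.exists_theta hpq
  -- With `(k y, l y)` as a plane vector attached to row `y`, `κ y` is its cross product with the
  -- vector of `v`, and `b y` the cotangent of the angle between them.
  let κ : V → ℝ := fun y => k v * l y - k y * l v
  let b : V → ℝ := fun y => (k v * k y + l v * l y) / κ y
  have key : ∀ y z y' z', DisjEdges (R.erase v) (T.erase t) M y z y' z' →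
      DisjEdges R T M y z y' z' ∧ DisjEdges R T M v t y z ∧ DisjEdges R T M v t y' z' := by
    intro y z y' z' ⟨h1, h2, h3, h4, h5, h6, h7, h8⟩
    rw [mem_erase] at h1 h2 h3 h4
    exact ⟨⟨h1.2, h2.2, h3.2, h4.2, h5, h6, h7, h8⟩,
      ⟨hv, ht, h1.2, h2.2, h1.1.symm, h2.1.symm, hvt, h7⟩,
      ⟨hv, ht, h3.2, h4.2, h3.1.symm, h4.1.symm, hvt, h8⟩⟩
  by_cases hex : ∃ y z y' z', DisjEdges (R.erase v) (T.erase t) M y z y' z'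
  swap
  · exact ⟨0, fun y z y' z' he => absurd ⟨y, z, y', z', he⟩ hex⟩
  obtain ⟨y₀, z₀, y₁, z₁, he₀⟩ := hex
  obtain ⟨he₁, he₂, -⟩ := key _ _ _ _ he₀
  set σ := theta M p q k l y₀ z₀ y₁ z₁ with hσ
  -- The factor `-σ` absorbs the common sign of `theta`.
  refine ⟨fun y => -σ * b y, fun y z y' z' he => ?_⟩
  obtain ⟨he₃, he₄, he₅⟩ := key _ _ _ _ he
  have hθ : ∀ y z, theta M p q k l v t y z = -(M v t * q t) * (M y z * p z * κ y) := by
    intro y z; simp only [theta, κ, hpt]; ring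
  have h1 := hkl _ _ _ _ _ _ _ _ he₁ he₃
  have h2 := hkl _ _ _ _ _ _ _ _ he₄ he₅
  rw [hθ, hθ] at h2
  -- Comparison with the edge `(v, t)`, where `p t = 0`, gives `M y z * p z * κ y` the same sign at
  -- all edges considered; this removes the matrix entries from `theta`.
  have h3 : 0 < (M y z * p z * κ y) * (M y' z' * p z' * κ y') := by
    have : -(M v t * q t) * (M y z * p z * κ y) * (-(M v t * q t) * (M y' z' * p z' * κ y'))
      = (M y z * p z * κ y) * (M y' z' * p z' * κ y') * (M v t * q t) ^ 2 := by ring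
    rw [this] at h2
    exact pos_of_mul_pos_left h2 (sq_nonneg _)
  have h3' := h3.ne'
  have hp1 : p z ≠ 0 := by rintro h; simp [h] at h3'
  have hp2 : p z' ≠ 0 := by rintro h; simp [h] at h3'
  have hκ1 : κ y ≠ 0 := by rintro h; simp [h] at h3'
  have hκ2 : κ y' ≠ 0 := by rintro h; simp [h] at h3'
  have h4 : (M y z * p z * κ y) * (M y' z' * p z' * κ y') * ((q z' / p z' - q z / p z)
      * (b y - b y')) = (k v ^ 2 + l v ^ 2) * theta M p q k l y z y' z' := by
    have e1 : p z * p z' * (q z' / p z' - q z / p z) = p z * q z' - p z' * q z := by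
      field_simp
    have e2 : κ y * κ y' * (b y - b y') = (k v ^ 2 + l v ^ 2) * (k y * l y' - k y' * l y) := by
      have : κ y * κ y' * (b y - b y') = (k v * k y + l v * l y) * κ y'
          - (k v * k y' + l v * l y') * κ y := by
        simp only [b]; field_simp
      rw [this]; simp only [κ]; ring
    calc _ = M y z * M y' z' * (p z * p z' * (q z' / p z' - q z / p z))
          * (κ y * κ y' * (b y - b y')) := by ring
      _ = _ := by rw [e1, e2]; simp only [theta]; ring
  have hkl0 : 0 < k v ^ 2 + l v ^ 2 := by
    rcases eq_or_ne (k v) 0 with hk0 | hk0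
    · have : l v ≠ 0 := by rintro hl0; simp [κ, hk0, hl0] at hκ1
      positivity
    · positivity
  have h5 : 0 < (M y z * p z * κ y) * (M y' z' * p z' * κ y') *
      ((q z' / p z' - q z / p z) * (-σ * b y' - -σ * b y)) := by
    have : (M y z * p z * κ y) * (M y' z' * p z' * κ y') *
      ((q z' / p z' - q z / p z) * (-σ * b y' - -σ * b y)) = (k v ^ 2 + l v ^ 2) *
        (σ * theta M p q k l y z y' z') := by
      linear_combination σ * h4
    rw [this]
    exact mul_pos hkl0 h1
  exact pos_of_mul_pos_right h5 h3.le

/-! ### Comonotone edge sets. -/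

/-- A bipartite graph whose disjoint edges are strictly comonotone is a forest. -/
lemma card_add_one_le_of_comonotone {a b : V → ℝ} (E : Finset (V × V)) (hE : E.Nonempty)
    (h : ∀ e ∈ E, ∀ e' ∈ E, e.1 ≠ e'.1 → e.2 ≠ e'.2 →
      0 < (a e'.2 - a e.2) * (b e'.1 - b e.1)) :
    E.card + 1 ≤ (E.image Prod.fst).card + (E.image Prod.snd).card := by
  induction E using Finset.strongInduction with
  | H E ih =>
    obtain ⟨e, he, hmax⟩ := exists_max_image E (fun e => a e.2) hE
    -- some edge has an end of degree one
    obtain ⟨g, hg, hleaf⟩ : ∃ g ∈ E, (∀ e' ∈ E, e'.1 = g.1 → e' = g) ∨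
        ∀ e' ∈ E, e'.2 = g.2 → e' = g := by
      by_contra! hc
      obtain ⟨-, e₂, he₂, h₂, hne₂⟩ := hc e he
      have h12 : e.1 ≠ e₂.1 := fun h' => hne₂ (Prod.ext h'.symm h₂)
      -- Of two rows meeting the column with the largest `a`, the one with the larger `b` has a
      -- further edge, to a column with no larger `a`. That edge and the edge of the other row are
      -- not strictly comonotone.
      have claim : ∀ x ∈ E, ∀ y ∈ E, x.1 ≠ y.1 → x.2 = e.2 → y.2 = e.2 → b x.1 ≤ b y.1 →
          False := by
        intro x hx y hy hne hx2 hy2 hb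
        obtain ⟨⟨z, hz, hz1, hz2⟩, -⟩ := hc y hy
        have hz3 : z.2 ≠ x.2 := fun h' => hz2 (Prod.ext hz1 (by rw [h', hx2, hy2]))
        have h3 := h x hx z hz (by rw [hz1]; exact hne) hz3.symm
        have h4 := hmax z hz
        rw [hx2, hz1] at h3
        have := mul_nonneg (sub_nonneg.2 h4) (sub_nonneg.2 hb)
        linarith
      rcases le_total (b e.1) (b e₂.1) with hb | hb
      · exact claim e he e₂ he₂ h12 rfl h₂ hb
      · exact claim e₂ he₂ e he h12.symm h₂ rfl hb
    have hcard := card_erase_add_one hg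
    have hsub1 : (E.erase g).image Prod.fst ⊆ E.image Prod.fst :=
      image_subset_image (erase_subset _ _)
    have hsub2 : (E.erase g).image Prod.snd ⊆ E.image Prod.snd :=
      image_subset_image (erase_subset _ _)
    rcases (E.erase g).eq_empty_or_nonempty with h0 | h0
    · rw [h0, card_empty] at hcard
      have h1 : 0 < (E.image Prod.fst).card := card_pos.2 (hE.image _)
      have h2 : 0 < (E.image Prod.snd).card := card_pos.2 (hE.image _)
      omega
    have key := ih _ (erase_ssubset hg) h0
      (fun e he e' he' => h e (mem_of_mem_erase he) e' (mem_of_mem_erase he'))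
    have hc1 := card_le_card hsub1
    have hc2 := card_le_card hsub2
    rcases hleaf with hl | hl
    · have : ((E.erase g).image Prod.fst).card < (E.image Prod.fst).card := by
        refine card_lt_card ⟨hsub1, fun h' => ?_⟩
        obtain ⟨x, hx, hx'⟩ := mem_image.1 (h' (mem_image_of_mem Prod.fst hg))
        exact (mem_erase.1 hx).1 (hl x (mem_erase.1 hx).2 hx')
      omega
    · have : ((E.erase g).image Prod.snd).card < (E.image Prod.snd).card := by
        refine card_lt_card ⟨hsub2, fun h' => ?_⟩
        obtain ⟨x, hx, hx'⟩ := mem_image.1 (h' (mem_image_of_mem Prod.snd hg))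
        exact (mem_erase.1 hx).1 (hl x (mem_erase.1 hx).2 hx')
      omega

/-! ### Counting edges -/

lemma ec_eq_sum (M : V → V → ℝ) (X Y : Finset V) :
    ec M X Y = ∑ i ∈ X, ∑ j ∈ Y, if M i j ≠ 0 then 1 else 0 := by
  rw [ec, card_filter, sum_product]

lemma ec_union_left {M : V → V → ℝ} {X X' : Finset V} (Y : Finset V) (h : Disjoint X X') :
    ec M (X ∪ X') Y = ec M X Y + ec M X' Y := by
  simp only [ec_eq_sum, sum_union h]

lemma ec_union_right {M : V → V → ℝ} (X : Finset V) {Y Y' : Finset V} (h : Disjoint Y Y') :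
    ec M X (Y ∪ Y') = ec M X Y + ec M X Y' := by
  simp only [ec_eq_sum, sum_union h, sum_add_distrib]

lemma ec_tr (M : V → V → ℝ) (X Y : Finset V) : ec (tr M) Y X = ec M X Y := by
  simp only [ec_eq_sum, tr]
  exact sum_comm

lemma ec_congr {M M' : V → V → ℝ} {X Y : Finset V}
    (h : ∀ i ∈ X, ∀ j ∈ Y, M i j ≠ 0 ↔ M' i j ≠ 0) : ec M X Y = ec M' X Y := by
  simp only [ec_eq_sum]
  exact sum_congr rfl fun i hi => sum_congr rfl fun j hj => by simp only [h i hi j hj]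

lemma ec_eq_zero {M : V → V → ℝ} {X Y : Finset V} (h : ∀ i ∈ X, ∀ j ∈ Y, M i j = 0) :
    ec M X Y = 0 := by
  rw [ec_eq_sum]
  exact sum_eq_zero fun i hi => sum_eq_zero fun j hj => by simp [h i hi j hj]

lemma ec_singleton_left (M : V → V → ℝ) (c : V) (Y : Finset V) :
    ec M {c} Y = (nbr M Y {c}).card := by
  rw [ec_eq_sum, sum_singleton, nbr, card_filter]
  simp

lemma ec_insert_left {M : V → V → ℝ} {c : V} {X : Finset V} (Y : Finset V) (h : c ∉ X) :
    ec M (insert c X) Y = ec M X Y + (nbr M Y {c}).card := by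
  rw [← ec_singleton_left, add_comm, ← ec_union_left Y (by simpa using h)]
  rfl

lemma ec_insert_right {M : V → V → ℝ} {c : V} (X : Finset V) {Y : Finset V} (h : c ∉ Y) :
    ec M X (insert c Y) = ec M X Y + (nbr (tr M) X {c}).card := by
  rw [← ec_tr, ec_insert_left X h, ec_tr]

lemma nbr_mono {M : V → V → ℝ} {B B' W W' : Finset V} (hB : B ⊆ B') (hW : W ⊆ W') :
    nbr M B W ⊆ nbr M B' W' := by
  intro j hj
  obtain ⟨hj, i, hi, hij⟩ := mem_nbr.1 hj
  exact mem_nbr.2 ⟨hB hj, i, hW hi, hij⟩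

/-! ### Braces -/

/-- A sign-nonsingular brace of order at least three. -/
structure SB (A B : Finset V) (M : V → V → ℝ) : Prop where
  good : Good A B M
  brace : Brace A B M
  card_eq : A.card = B.card
  three_le : 3 ≤ A.card

lemma Brace.transpose {A B : Finset V} {M : V → V → ℝ} (h : Brace A B M)
    (hAB : A.card = B.card) : Brace B A (tr M) := by
  intro P hP L hL hPn hLn hPL
  have := h L hL P hP hLn hPn (fun i hi j hj => hPL j hj i hi)
  omega

lemma SB.transpose {A B : Finset V} {M : V → V → ℝ} (h : SB A B M) : SB B A (tr M) :=
  ⟨h.good.transpose h.card_eq, h.brace.transpose h.card_eq, h.card_eq.symm,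
    h.card_eq ▸ h.three_le⟩

lemma SB.card_nbr {A B : Finset V} {M : V → V → ℝ} (h : SB A B M) {W : Finset V} (hW : W ⊆ A)
    (hWn : W.Nonempty) (hc : W.card + 2 ≤ A.card) : W.card + 2 ≤ (nbr M B W).card := by
  have hcard := card_sdiff_add_card_eq_card (nbr_subset (M := M) (B := B) (W := W))
  have := h.card_eq
  rcases (B \ nbr M B W).eq_empty_or_nonempty with h0 | h0
  · rw [h0, card_empty] at hcard
    omega
  · have := h.brace W hW _ sdiff_subset hWn h0 (by
      intro i hi j hj
      obtain ⟨hj1, hj2⟩ := mem_sdiff.1 hj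
      by_contra hne
      exact hj2 (mem_nbr.2 ⟨hj1, i, hi, hne⟩))
    omega

lemma SB.card_nbr_tr {A B : Finset V} {M : V → V → ℝ} (h : SB A B M) {W : Finset V} (hW : W ⊆ B)
    (hWn : W.Nonempty) (hc : W.card + 2 ≤ A.card) : W.card + 2 ≤ (nbr (tr M) A W).card :=
  h.transpose.card_nbr hW hWn (h.card_eq ▸ hc)

/-! ### Separations by a single edge. -/

/-- Sets `X`, `Y` of total size one less than the order, joined at most by the edge `(u, t)`. -/
structure Sep (A B : Finset V) (M : V → V → ℝ) (u t : V) (X Y : Finset V) : Prop where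
  rows : X ⊆ A
  cols : Y ⊆ B
  mem_row : u ∈ X
  mem_col : t ∈ Y
  edge : ∀ i ∈ X, ∀ j ∈ Y, M i j ≠ 0 → i = u ∧ j = t
  card : X.card + Y.card + 1 = A.card

lemma Sep.transpose {A B : Finset V} {M : V → V → ℝ} {u t : V} {X Y : Finset V}
    (h : Sep A B M u t X Y) (hAB : A.card = B.card) : Sep B A (tr M) t u Y X :=
  ⟨h.cols, h.rows, h.mem_col, h.mem_row, fun i hi j hj hij => (h.edge j hj i hi hij).symm,
    by have := h.card; omega⟩

/-- Dropping `t` from `Y`, or `u` from `X`, leaves nonadjacent sets and costs one in the brace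
inequality. If both sets are singletons, order three suffices. -/
lemma SB.card_le_of_edge {A B : Finset V} {M : V → V → ℝ} (h : SB A B M) {u t : V}
    {X Y : Finset V} (hX : X ⊆ A) (hY : Y ⊆ B) (hu : u ∈ X) (ht : t ∈ Y)
    (he : ∀ i ∈ X, ∀ j ∈ Y, M i j ≠ 0 → i = u ∧ j = t) : X.card + Y.card + 1 ≤ A.card := by
  have h3 := h.three_le
  have hc1 := card_erase_add_one ht
  have hc2 := card_erase_add_one hu
  rcases (Y.erase t).eq_empty_or_nonempty with h0 | h0
  · rcases (X.erase u).eq_empty_or_nonempty with h1 | h1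
    · rw [h0, card_empty] at hc1
      rw [h1, card_empty] at hc2
      omega
    · have := h.brace _ ((erase_subset _ _).trans hX) Y hY h1 ⟨t, ht⟩ (by
        intro i hi j hj
        by_contra hne
        exact (mem_erase.1 hi).1 (he i (mem_of_mem_erase hi) j hj hne).1)
      omega
  · have := h.brace X hX _ ((erase_subset _ _).trans hY) ⟨u, hu⟩ h0 (by
      intro i hi j hj
      by_contra hne
      exact (mem_erase.1 hj).1 (he i hi j (mem_of_mem_erase hj) hne).2)
    omega

/-- `X` and `Y ∪ Y'` are again joined only by `(u, t)`, and the size bound leaves no room beyond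
`Y`. -/
lemma SB.sep_anti {A B : Finset V} {M : V → V → ℝ} (h : SB A B M) {u t : V}
    {X Y X' Y' : Finset V} (hS : Sep A B M u t X Y) (hS' : Sep A B M u t X' Y') (hX : X ⊆ X') :
    Y' ⊆ Y := by
  have h1 := h.card_le_of_edge hS.rows (union_subset hS.cols hS'.cols) hS.mem_row
    (mem_union_left _ hS.mem_col) (by
      intro i hi j hj hij
      rcases mem_union.1 hj with hj | hj
      · exact hS.edge i hi j hj hij
      · exact hS'.edge i (hX hi) j hj hij)
  have h2 := hS.card
  have h3 : Y ∪ Y' = Y := (eq_of_subset_of_card_le subset_union_left (by omega)).symm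
  rw [← h3]; exact subset_union_right

lemma Sep.card_sdiff_rows {A B : Finset V} {M : V → V → ℝ} {u t : V} {X Y : Finset V}
    (h : Sep A B M u t X Y) : (A \ X).card = Y.card + 1 := by
  have := card_sdiff_add_card_eq_card h.rows
  have := h.card
  omega

lemma Sep.card_sdiff_cols {A B : Finset V} {M : V → V → ℝ} {u t : V} {X Y : Finset V}
    (h : Sep A B M u t X Y) (hAB : A.card = B.card) : (B \ Y).card = X.card + 1 :=
  (h.transpose hAB).card_sdiff_rows

/-- Rows of `X` have one more neighbour outside `Y` than rows. -/
lemma SB.card_nbr_sdiff {A B : Finset V} {M : V → V → ℝ} (h : SB A B M) {u t : V}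
    {X Y : Finset V} (hS : Sep A B M u t X Y) {W : Finset V} (hW : W ⊆ X) (hWn : W.Nonempty) :
    W.card + 1 ≤ (nbr M (B \ Y) W).card := by
  have h1 := hS.card
  have h2 := card_le_card hW
  have h3 := card_pos.2 ⟨t, hS.mem_col⟩
  have h4 := h.card_nbr (hW.trans hS.rows) hWn (by omega)
  have h5 : nbr M B W ⊆ insert t (nbr M (B \ Y) W) := by
    intro j hj
    obtain ⟨hjB, i, hi, hij⟩ := mem_nbr.1 hj
    by_cases hjY : j ∈ Y
    · rw [(hS.edge i (hW hi) j hjY hij).2]; exact mem_insert_self _ _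
    · exact mem_insert_of_mem (mem_nbr.2 ⟨mem_sdiff.2 ⟨hjB, hjY⟩, i, hi, hij⟩)
  have h6 := card_le_card h5
  have h7 := card_insert_le t (nbr M (B \ Y) W)
  omega

lemma SB.pm_left {A B : Finset V} {M : V → V → ℝ} (h : SB A B M) {u t : V} {X Y : Finset V}
    (hS : Sep A B M u t X Y) (z z' : V) : PM X (insert t (B \ Y) \ {z, z'}) M := by
  apply PM_of_hall
  intro W hW hWn
  have h1 := hS.card
  have h2 := card_le_card hW
  have h3 := card_pos.2 ⟨t, hS.mem_col⟩
  have h4 := h.card_nbr (hW.trans hS.rows) hWn (by omega)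
  have h5 : nbr M B W \ {z, z'} ⊆ nbr M (insert t (B \ Y) \ {z, z'}) W := by
    intro j hj
    obtain ⟨hj, hjz⟩ := mem_sdiff.1 hj
    obtain ⟨hjB, i, hi, hij⟩ := mem_nbr.1 hj
    refine mem_nbr.2 ⟨mem_sdiff.2 ⟨?_, hjz⟩, i, hi, hij⟩
    by_cases hjY : j ∈ Y
    · rw [(hS.edge i (hW hi) j hjY hij).2]; exact mem_insert_self _ _
    · exact mem_insert_of_mem (mem_sdiff.2 ⟨hjB, hjY⟩)
  have h6 := card_le_card h5
  have h7 := le_card_sdiff {z, z'} (nbr M B W)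
  have h8 := card_le_two (a := z) (b := z')
  omega

lemma SB.pm_right {A B : Finset V} {M : V → V → ℝ} (h : SB A B M) {u t : V} {X Y : Finset V}
    (hS : Sep A B M u t X Y) {y y' : V} (hy : y ∈ A \ X) (hy' : y' ∈ A \ X) (hne : y ≠ y') :
    PM ((A \ X) \ {y, y'}) (Y.erase t) M := by
  have hyy : ({y, y'} : Finset V) ⊆ A \ X := by
    intro a ha; simp only [mem_insert, mem_singleton] at ha; rcases ha with rfl | rfl <;> assumption
  have h0 : PM (Y.erase t) ((A \ X) \ {y, y'}) (tr M) := by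
    apply PM_of_hall
    intro W hW hWn
    have hWY := hW.trans (erase_subset _ _)
    have h1 := hS.card
    have h2 := card_le_card hWY
    have h3 := card_pos.2 ⟨u, hS.mem_row⟩
    have h4 := h.card_nbr_tr (hWY.trans hS.cols) hWn (by omega)
    have h5 : nbr (tr M) A W \ {y, y'} ⊆ nbr (tr M) ((A \ X) \ {y, y'}) W := by
      intro j hj
      obtain ⟨hj, hjz⟩ := mem_sdiff.1 hj
      obtain ⟨hjB, i, hi, hij⟩ := mem_nbr.1 hj
      refine mem_nbr.2 ⟨mem_sdiff.2 ⟨mem_sdiff.2 ⟨hjB, fun hjX => ?_⟩, hjz⟩, i, hi, hij⟩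
      exact (mem_erase.1 (hW hi)).1 (hS.edge j hjX i (hWY hi) hij).2
    have h6 := card_le_card h5
    have h7 := le_card_sdiff {y, y'} (nbr (tr M) A W)
    have h8 := card_le_two (a := y) (b := y')
    omega
  refine h0.transpose (le_of_eq ?_)
  rw [card_sdiff_of_subset hyy, hS.card_sdiff_rows, card_pair hne, card_erase_of_mem hS.mem_col]
  rfl

/-- Once `t` joins `B \ Y`, all neighbours of `X` lie in `T` and all neighbours of `Q` in `R`. The
surplus two of a brace pays for the two deleted columns or rows. -/
lemma SB.cut {A B : Finset V} {M : V → V → ℝ} (h : SB A B M) {u t : V} {X Y : Finset V}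
    (hS : Sep A B M u t X Y) : Cut X (A \ X) (insert t (B \ Y)) (Y.erase t) M := by
  have ht : t ∉ B \ Y := by simp [hS.mem_col]
  refine ⟨?_, disjoint_sdiff, ?_, ?_, ?_, fun z _ z' _ _ => h.pm_left hS z z',
    fun y hy y' hy' hne => h.pm_right hS hy hy' hne⟩
  · have : insert t (B \ Y) ∪ Y.erase t = B := by
      rw [insert_union, ← union_insert, insert_erase hS.mem_col, sdiff_union_of_subset hS.cols]
    rw [this, union_sdiff_of_subset hS.rows]
    exact h.good
  · rw [disjoint_left]
    intro a ha ha'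
    rcases mem_insert.1 ha with rfl | ha
    · simp at ha'
    · exact (mem_sdiff.1 ha).2 (mem_of_mem_erase ha')
  · rw [card_insert_of_notMem ht, hS.card_sdiff_cols h.card_eq]
  · rw [hS.card_sdiff_rows, ← card_erase_add_one hS.mem_col]

/-! ### Smaller braces obtained by contraction. -/

/-- The edge bound for sign-nonsingular braces of order less than `n`. -/
def EdgeBoundBelow (V : Type*) (n : ℕ) : Prop :=
  ∀ (A B : Finset V) (M : V → V → ℝ), A.card < n → 2 ≤ A.card → A.card = B.card →
    Good A B M → Brace A B M → ec M A B + 4 ≤ 4 * A.card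

/-- The edge bound for the piece obtained by contracting everything outside a minimal `X`. -/
lemma SB.ec_le_of_minimal {A B : Finset V} {M : V → V → ℝ} (h : SB A B M)
    (ih : EdgeBoundBelow V A.card) {u t : V} {X Y : Finset V} (hS : Sep A B M u t X Y)
    (hmin : ∀ X' Y', Sep A B M u t X' Y' → X' ⊆ X → X' = X) :
    ec M X (B \ Y) + (nbr M (B \ Y) (A \ X)).card ≤ 4 * X.card := by
  have hc1 := hS.card_sdiff_rows
  have hc2 := hS.card_sdiff_cols h.card_eq
  have hc3 := hS.card
  have hAB := h.card_eq
  have hX0 := card_pos.2 ⟨u, hS.mem_row⟩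
  have hY0 := card_pos.2 ⟨t, hS.mem_col⟩
  obtain ⟨c, hc⟩ : (A \ X).Nonempty := card_pos.1 (by omega)
  have hcX : c ∉ X := (mem_sdiff.1 hc).2
  obtain ⟨M', hG, hM1, hM2⟩ := h.good.collapse_rows hAB (sdiff_subset (t := X)) hS.cols hc1 hc
    (by
      intro W hW hWn
      exact h.transpose.card_nbr_sdiff (hS.transpose hAB) hW hWn)
  rw [Finset.sdiff_sdiff_eq_self hS.rows] at hG
  have hcard : (insert c X).card = X.card + 1 := card_insert_of_notMem hcX
  -- If `c ∈ P`, it is replaced by `A \ X`. Otherwise `Y` is adjoined to `L`; when `u ∈ P`, equality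
  -- would give a separation with rows inside `X`, and minimality then leaves `L` empty.
  have hbr : Brace (insert c X) (B \ Y) M' := by
    intro P hP L hL hPn hLn hPL
    have hLB : L ⊆ B := hL.trans sdiff_subset
    have hLY : Disjoint L Y := disjoint_of_subset_left hL sdiff_disjoint
    have hLpos := card_pos.2 hLn
    rw [hcard]
    by_cases hcP : c ∈ P
    · have hP' : P.erase c ⊆ X := by
        intro i hi
        exact (mem_insert.1 (hP (mem_of_mem_erase hi))).resolve_left (mem_erase.1 hi).1
      have hdisj : Disjoint (A \ X) (P.erase c) := disjoint_of_subset_right hP' sdiff_disjoint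
      have h1 := h.brace ((A \ X) ∪ P.erase c) (union_subset sdiff_subset (hP'.trans hS.rows)) L hLB
        ⟨c, mem_union_left _ hc⟩ hLn (by
          intro i hi j hj
          rcases mem_union.1 hi with hi | hi
          · by_contra hne
            exact ((hM2 j).2 ⟨i, hi, hne⟩) (hPL c hcP j hj)
          · rw [← hM1 i j (mem_erase.1 hi).1]
            exact hPL i (mem_of_mem_erase hi) j hj)
      rw [card_union_of_disjoint hdisj] at h1
      have := card_erase_add_one hcP
      omega
    · have hP' : P ⊆ X := by
        intro i hi
        refine (mem_insert.1 (hP hi)).resolve_left ?_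
        rintro rfl; exact hcP hi
      have hPL' : ∀ i ∈ P, ∀ j ∈ L, M i j = 0 := by
        intro i hi j hj
        rw [← hM1 i j (by rintro rfl; exact hcP hi)]
        exact hPL i hi j hj
      have hcU := card_union_of_disjoint hLY
      by_cases hu : u ∈ P
      · have hedge : ∀ i ∈ P, ∀ j ∈ L ∪ Y, M i j ≠ 0 → i = u ∧ j = t := by
          intro i hi j hj hij
          rcases mem_union.1 hj with hj | hj
          · exact absurd (hPL' i hi j hj) hij
          · exact hS.edge i (hP' hi) j hj hij
        have h1 := h.card_le_of_edge (hP'.trans hS.rows) (union_subset hLB hS.cols) hu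
          (mem_union_right _ hS.mem_col) hedge
        by_contra hlt
        have h2 := hmin P (L ∪ Y) ⟨hP'.trans hS.rows, union_subset hLB hS.cols, hu,
          mem_union_right _ hS.mem_col, hedge, by omega⟩ hP'
        rw [h2] at h1
        omega
      · have h1 := h.brace P (hP'.trans hS.rows) (L ∪ Y) (union_subset hLB hS.cols) hPn
          ⟨t, mem_union_right _ hS.mem_col⟩ (by
            intro i hi j hj
            rcases mem_union.1 hj with hj | hj
            · exact hPL' i hi j hj
            · by_contra hne
              have := (hS.edge i (hP' hi) j hj hne).1
              subst this; exact hu hi)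
        omega
  have key := ih _ _ M' (by omega) (by omega) (by omega) hG hbr
  rw [ec_insert_left _ hcX] at key
  have e1 : ec M' X (B \ Y) = ec M X (B \ Y) := ec_congr (by
    intro i hi j hj
    rw [hM1 i j (by rintro rfl; exact hcX hi)])
  have e2 : nbr M' (B \ Y) {c} = nbr M (B \ Y) (A \ X) := by
    ext j
    simp only [mem_nbr, mem_singleton, exists_eq_left, hM2]
  rw [e1, e2] at key
  omega

/-- `(X', Y')` is a minimal separation strictly above `(X, Y)`. -/
structure Cov (A B : Finset V) (M : V → V → ℝ) (u t : V) (X Y X' Y' : Finset V) : Prop where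
  sep : Sep A B M u t X Y
  sep' : Sep A B M u t X' Y'
  ssub : X ⊂ X'
  cover : ∀ X'' Y'', Sep A B M u t X'' Y'' → X ⊆ X'' → X'' ⊆ X' → X'' = X ∨ X'' = X'

lemma Cov.cols_subset {A B : Finset V} {M : V → V → ℝ} {u t : V} {X Y X' Y' : Finset V}
    (hC : Cov A B M u t X Y X' Y') (h : SB A B M) : Y' ⊆ Y :=
  h.sep_anti hC.sep hC.sep' hC.ssub.1

lemma Cov.card_rows {A B : Finset V} {M : V → V → ℝ} {u t : V} {X Y X' Y' : Finset V}
    (hC : Cov A B M u t X Y X' Y') : (X' \ X).card + X.card = X'.card :=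
  card_sdiff_add_card_eq_card hC.ssub.1

lemma Cov.card_cols {A B : Finset V} {M : V → V → ℝ} {u t : V} {X Y X' Y' : Finset V}
    (hC : Cov A B M u t X Y X' Y') (h : SB A B M) : (Y \ Y').card + Y'.card = Y.card :=
  card_sdiff_add_card_eq_card (hC.cols_subset h)

/-- Between the two separations of a cover there is room for strictly smaller nonadjacent sets. -/
lemma Cov.card_lt {A B : Finset V} {M : V → V → ℝ} {u t : V} {X Y X' Y' : Finset V}
    (hC : Cov A B M u t X Y X' Y') (h : SB A B M) {P L : Finset V} (hP : P ⊆ X' \ X)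
    (hL : L ⊆ Y \ Y') (hPn : P.Nonempty) (hLn : L.Nonempty)
    (hPL : ∀ i ∈ P, ∀ j ∈ L, M i j = 0) : P.card + L.card + 1 ≤ (X' \ X).card := by
  have hYY := hC.cols_subset h
  have c1 := hC.card_rows
  have c2 := hC.card_cols h
  have c3 := hC.sep.card
  have c4 := hC.sep'.card
  have hd1 : Disjoint X P := disjoint_of_subset_right hP disjoint_sdiff
  have hd2 : Disjoint Y' L := disjoint_of_subset_right hL disjoint_sdiff
  have hPX : P ⊆ X' := hP.trans sdiff_subset
  have hLY : L ⊆ Y := hL.trans sdiff_subset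
  have hXP : X ∪ P ⊆ X' := union_subset hC.ssub.1 hPX
  have hYL : Y' ∪ L ⊆ Y := union_subset hYY hLY
  have c5 := card_union_of_disjoint hd1
  have c6 := card_union_of_disjoint hd2
  have c7 := card_pos.2 hPn
  have c8 := card_pos.2 hLn
  have hedge : ∀ i ∈ X ∪ P, ∀ j ∈ Y' ∪ L, M i j ≠ 0 → i = u ∧ j = t := by
    intro i hi j hj hij
    rcases mem_union.1 hj with hj | hj
    · exact hC.sep'.edge i (hXP hi) j hj hij
    · rcases mem_union.1 hi with hi | hi
      · exact hC.sep.edge i hi j (hLY hj) hij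
      · exact absurd (hPL i hi j hj) hij
  have h1 := h.card_le_of_edge (hXP.trans hC.sep'.rows) (hYL.trans hC.sep.cols)
    (mem_union_left _ hC.sep.mem_row) (mem_union_left _ hC.sep'.mem_col) hedge
  by_contra hlt
  have h2 := hC.cover (X ∪ P) (Y' ∪ L) ⟨hXP.trans hC.sep'.rows, hYL.trans hC.sep.cols,
    mem_union_left _ hC.sep.mem_row, mem_union_left _ hC.sep'.mem_col, hedge, by omega⟩
    subset_union_left hXP
  rcases h2 with h2 | h2
  · rw [h2] at c5; omega
  · rw [h2] at h1
    omega

/-- Contracting the outside at both ends, to a row `c` and a column `d`, gives a smaller brace of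
order `(X' \ X).card + 1`. The further terms on the left count the entries of column `d`, of row
`c`, and the corner entry. -/
lemma Cov.ec_piece {A B : Finset V} {M : V → V → ℝ} {u t : V} {X Y X' Y' : Finset V}
    (hC : Cov A B M u t X Y X' Y') (h : SB A B M) (ih : EdgeBoundBelow V A.card) :
    ec M (X' \ X) (Y \ Y') + (nbr (tr M) (X' \ X) (B \ Y)).card
      + (nbr M (Y \ Y') (A \ X')).card + (if (nbr M (B \ Y) (A \ X')).Nonempty then 1 else 0)
      ≤ 4 * (X' \ X).card := by
  have hAB := h.card_eq
  have hYY := hC.cols_subset h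
  have c1 := hC.card_rows
  have c2 := hC.card_cols h
  have c3 := hC.sep.card
  have c4 := hC.sep'.card
  have c5 := hC.sep.card_sdiff_cols hAB
  have c6 := hC.sep'.card_sdiff_rows
  have c7 := card_pos.2 ⟨u, hC.sep.mem_row⟩
  have c8 := card_pos.2 ⟨t, hC.sep'.mem_col⟩
  have c9 := card_lt_card hC.ssub
  obtain ⟨c, hc⟩ : (A \ X').Nonempty := card_pos.1 (by omega)
  obtain ⟨d, hd⟩ : (B \ Y).Nonempty := card_pos.1 (by omega)
  have hcX' : c ∉ X' := (mem_sdiff.1 hc).2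
  have hcX : c ∉ X := fun h => hcX' (hC.ssub.1 h)
  have hdY : d ∉ Y := (mem_sdiff.1 hd).2
  have hXB : B \ Y ⊆ B \ Y' := sdiff_subset_sdiff le_rfl hYY
  obtain ⟨M₁, hG₁, hM₁, hM₁'⟩ := h.good.collapse_rows hAB (sdiff_subset (t := X')) hC.sep'.cols c6 hc
    (by
      intro W hW hWn
      exact h.transpose.card_nbr_sdiff (hC.sep'.transpose hAB) hW hWn)
  rw [Finset.sdiff_sdiff_eq_self hC.sep'.rows] at hG₁
  have hM₁X : ∀ i ∈ X', ∀ j, M₁ i j = M i j := by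
    intro i hi j
    exact hM₁ i j (by rintro rfl; exact hcX' hi)
  obtain ⟨M₂, hG₂, hM₂, hM₂'⟩ := hG₁.collapse_cols (S := X) (T := B \ Y)
    (hC.ssub.1.trans (subset_insert _ _)) hXB hd (by
      intro W hW hWn
      have h1 := h.card_nbr_sdiff hC.sep hW hWn
      refine h1.trans (card_le_card ?_)
      intro j hj
      obtain ⟨hj, i, hi, hij⟩ := mem_nbr.1 hj
      exact mem_nbr.2 ⟨hj, i, hi, by rwa [hM₁X i (hC.ssub.1 (hW hi))]⟩)
  have er : insert c X' \ X = insert c (X' \ X) := insert_sdiff_of_notMem _ hcX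
  have ecl : (B \ Y') \ (B \ Y) = Y \ Y' := by
    ext j
    have := @hYY j
    have hYB := hC.sep.cols
    have := @hYB j
    simp only [mem_sdiff]; tauto
  rw [er, ecl] at hG₂
  have hcD : c ∉ X' \ X := fun h => hcX' (mem_sdiff.1 h).1
  have hdD : d ∉ Y \ Y' := fun h => hdY (mem_sdiff.1 h).1
  have k1 : (insert c (X' \ X)).card = (X' \ X).card + 1 := card_insert_of_notMem hcD
  have k2 : (insert d (Y \ Y')).card = (Y \ Y').card + 1 := card_insert_of_notMem hdD
  -- the four types of entries of the piece
  have z1 : ∀ i ∈ X' \ X, ∀ j ∈ Y \ Y', M₂ i j = M i j := by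
    intro i hi j hj
    rw [hM₂ i j (by rintro rfl; exact hdD hj), hM₁X i (mem_sdiff.1 hi).1]
  have z2 : ∀ j ∈ Y \ Y', M₂ c j ≠ 0 ↔ ∃ y ∈ A \ X', M y j ≠ 0 := by
    intro j hj
    rw [hM₂ c j (by rintro rfl; exact hdD hj), hM₁']
  have z3 : ∀ i ∈ X' \ X, M₂ i d ≠ 0 ↔ ∃ z ∈ B \ Y, M i z ≠ 0 := by
    intro i hi
    rw [hM₂']
    simp only [hM₁X i (mem_sdiff.1 hi).1]
  have z4 : M₂ c d ≠ 0 ↔ ∃ z ∈ B \ Y, ∃ y ∈ A \ X', M y z ≠ 0 := by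
    rw [hM₂']
    simp only [hM₁']
  have hXA := hC.sep.rows
  have hX'A := hC.sep'.rows
  have hYB := hC.sep.cols
  have hY'B := hC.sep'.cols
  -- Contracted vertices are expanded back. When only `c` occurs, `X` is adjoined too, since its
  -- sole edge into `Y` ends at `t`, outside `L`; dually when only `d` occurs. Without `c` and `d`
  -- the cover property applies.
  have hbr : Brace (insert c (X' \ X)) (insert d (Y \ Y')) M₂ := by
    intro P hP L hL hPn hLn hPL
    rw [k1]
    have hPe : P.erase c ⊆ X' \ X := by
      intro i hi
      exact (mem_insert.1 (hP (mem_of_mem_erase hi))).resolve_left (mem_erase.1 hi).1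
    have hLe : L.erase d ⊆ Y \ Y' := by
      intro i hi
      exact (mem_insert.1 (hL (mem_of_mem_erase hi))).resolve_left (mem_erase.1 hi).1
    have hPLe : ∀ i ∈ P.erase c, ∀ j ∈ L.erase d, M i j = 0 := by
      intro i hi j hj
      rw [← z1 i (hPe hi) j (hLe hj)]
      exact hPL i (mem_of_mem_erase hi) j (mem_of_mem_erase hj)
    have hcPL : c ∈ P → ∀ i ∈ A \ X', ∀ j ∈ L.erase d, M i j = 0 := by
      intro hcP i hi j hj
      by_contra hne
      exact (z2 j (hLe hj)).2 ⟨i, hi, hne⟩ (hPL c hcP j (mem_of_mem_erase hj))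
    have hdPL : d ∈ L → ∀ i ∈ P.erase c, ∀ j ∈ B \ Y, M i j = 0 := by
      intro hdL i hi j hj
      by_contra hne
      exact (z3 i (hPe hi)).2 ⟨j, hj, hne⟩ (hPL i (mem_of_mem_erase hi) d hdL)
    have hcd : c ∈ P → d ∈ L → ∀ i ∈ A \ X', ∀ j ∈ B \ Y, M i j = 0 := by
      intro hcP hdL i hi j hj
      by_contra hne
      exact z4.2 ⟨j, hj, i, hi, hne⟩ (hPL c hcP d hdL)
    have hPA : P.erase c ⊆ A := hPe.trans (sdiff_subset.trans hX'A)
    have hLB : L.erase d ⊆ B := hLe.trans (sdiff_subset.trans hYB)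
    have d1 : Disjoint (A \ X') (P.erase c) :=
      disjoint_of_subset_right (hPe.trans sdiff_subset) sdiff_disjoint
    have d2 : Disjoint (B \ Y) (L.erase d) :=
      disjoint_of_subset_right (hLe.trans sdiff_subset) sdiff_disjoint
    by_cases hcP : c ∈ P <;> by_cases hdL : d ∈ L
    · have kP := card_erase_add_one hcP
      have kL := card_erase_add_one hdL
      have h1 := h.brace ((A \ X') ∪ P.erase c) (union_subset sdiff_subset hPA)
        ((B \ Y) ∪ L.erase d) (union_subset sdiff_subset hLB) ⟨c, mem_union_left _ hc⟩
        ⟨d, mem_union_left _ hd⟩ (by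
          intro i hi j hj
          rcases mem_union.1 hi with hi | hi <;> rcases mem_union.1 hj with hj | hj
          · exact hcd hcP hdL i hi j hj
          · exact hcPL hcP i hi j hj
          · exact hdPL hdL i hi j hj
          · exact hPLe i hi j hj)
      rw [card_union_of_disjoint d1, card_union_of_disjoint d2] at h1
      omega
    · have kP := card_erase_add_one hcP
      have kL : (L.erase d).card = L.card := by rw [erase_eq_of_notMem hdL]
      have d3 : Disjoint ((A \ X') ∪ P.erase c) X := by
        rw [disjoint_union_left]
        exact ⟨disjoint_of_subset_right hC.ssub.1 sdiff_disjoint,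
          disjoint_of_subset_left hPe sdiff_disjoint⟩
      have h1 := h.brace (((A \ X') ∪ P.erase c) ∪ X)
        (union_subset (union_subset sdiff_subset hPA) hXA) (L.erase d) hLB
        ⟨c, mem_union_left _ (mem_union_left _ hc)⟩ (by rwa [erase_eq_of_notMem hdL]) (by
          intro i hi j hj
          rcases mem_union.1 hi with hi | hi
          · rcases mem_union.1 hi with hi | hi
            · exact hcPL hcP i hi j hj
            · exact hPLe i hi j hj
          · by_contra hne
            obtain ⟨-, rfl⟩ := hC.sep.edge i hi j (mem_sdiff.1 (hLe hj)).1 hne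
            exact (mem_sdiff.1 (hLe hj)).2 hC.sep'.mem_col)
      rw [card_union_of_disjoint d3, card_union_of_disjoint d1] at h1
      omega
    · have kP : (P.erase c).card = P.card := by rw [erase_eq_of_notMem hcP]
      have kL := card_erase_add_one hdL
      have d3 : Disjoint ((B \ Y) ∪ L.erase d) Y' := by
        rw [disjoint_union_left]
        exact ⟨disjoint_of_subset_right hYY sdiff_disjoint,
          disjoint_of_subset_left hLe sdiff_disjoint⟩
      have h1 := h.brace (P.erase c) hPA (((B \ Y) ∪ L.erase d) ∪ Y')
        (union_subset (union_subset sdiff_subset hLB) hY'B) (by rwa [erase_eq_of_notMem hcP])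
        ⟨d, mem_union_left _ (mem_union_left _ hd)⟩ (by
          intro i hi j hj
          rcases mem_union.1 hj with hj | hj
          · rcases mem_union.1 hj with hj | hj
            · exact hdPL hdL i hi j hj
            · exact hPLe i hi j hj
          · by_contra hne
            obtain ⟨rfl, -⟩ := hC.sep'.edge i (mem_sdiff.1 (hPe hi)).1 j hj hne
            exact (mem_sdiff.1 (hPe hi)).2 hC.sep.mem_row)
      rw [card_union_of_disjoint d3, card_union_of_disjoint d2] at h1
      omega
    · rw [erase_eq_of_notMem hcP] at hPe hPLe
      rw [erase_eq_of_notMem hdL] at hLe hPLe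
      have := hC.card_lt h hPe hLe hPn hLn hPLe
      omega
  have key := ih (insert c (X' \ X)) (insert d (Y \ Y')) M₂ (by omega) (by omega) (by omega) hG₂ hbr
  rw [ec_insert_left _ hcD, ec_insert_right _ hdD, k1] at key
  have e1 : ec M₂ (X' \ X) (Y \ Y') = ec M (X' \ X) (Y \ Y') :=
    ec_congr fun i hi j hj => by rw [z1 i hi j hj]
  have e2 : nbr (tr M₂) (X' \ X) {d} = nbr (tr M) (X' \ X) (B \ Y) := by
    ext i
    simp only [mem_nbr, mem_singleton, exists_eq_left]
    exact and_congr_right fun hi => z3 i hi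
  have e3 : (nbr M₂ (insert d (Y \ Y')) {c}).card = (nbr M (Y \ Y') (A \ X')).card
      + (if (nbr M (B \ Y) (A \ X')).Nonempty then 1 else 0) := by
    have e4 : nbr M₂ (Y \ Y') {c} = nbr M (Y \ Y') (A \ X') := by
      ext j
      simp only [mem_nbr, mem_singleton, exists_eq_left]
      exact and_congr_right fun hj => z2 j hj
    have e5 : M₂ c d ≠ 0 ↔ (nbr M (B \ Y) (A \ X')).Nonempty := by
      rw [z4]
      constructor
      · rintro ⟨z, hz, hy⟩; exact ⟨z, mem_nbr.2 ⟨hz, hy⟩⟩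
      · rintro ⟨z, hz⟩; exact ⟨z, mem_nbr.1 hz⟩
    rw [← e4, nbr, filter_insert]
    simp only [mem_singleton, exists_eq_left]
    by_cases hne : M₂ c d ≠ 0
    · rw [if_pos hne, if_pos (e5.1 hne), card_insert_of_notMem (by simp [hdD])]
      simp [nbr]
    · rw [if_neg hne, if_neg (fun h' => hne (e5.2 h'))]
      simp [nbr]
  rw [e1, e2, e3] at key
  omega

/-- Absorbing the intermediate rows `X' \ X` into `w` makes their neighbours count as neighbours of
`w`, so that the sign arguments for cuts apply to them jointly. -/
lemma Cov.exists_cut {A B : Finset V} {M : V → V → ℝ} {u t : V} {X Y X' Y' : Finset V}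
    (hC : Cov A B M u t X Y X' Y') (h : SB A B M) {w : V} (hw : w ∈ A \ X')
    (hwY : ∃ j ∈ Y \ Y', M w j ≠ 0) :
    ∃ M' : V → V → ℝ, Cut X (A \ X') (insert t (B \ Y)) (Y'.erase t) M' ∧
      (∀ i j, i ≠ w → M' i j = M i j) ∧
      ∀ j, M' w j ≠ 0 ↔ ∃ y ∈ insert w (X' \ X), M y j ≠ 0 := by
  have hAB := h.card_eq
  have hYY := hC.cols_subset h
  have c1 := hC.card_rows
  have c2 := hC.card_cols h
  have c3 := hC.sep.card
  have c4 := hC.sep'.card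
  have hwX' : w ∉ X' := (mem_sdiff.1 hw).2
  have hwX : w ∉ X := fun h => hwX' (hC.ssub.1 h)
  have hwD : w ∉ X' \ X := fun h => hwX' (mem_sdiff.1 h).1
  have hXA := hC.sep.rows
  have hX'A := hC.sep'.rows
  have hYB := hC.sep.cols
  have hPA : insert w (X' \ X) ⊆ A :=
    insert_subset (mem_sdiff.1 hw).1 (sdiff_subset.trans hX'A)
  obtain ⟨M', hG, hM, hM'⟩ := h.good.collapse_rows hAB hPA (sdiff_subset.trans hYB : Y \ Y' ⊆ B)
    (by rw [card_insert_of_notMem hwD]; omega) (mem_insert_self _ _) (by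
      intro W hW hWn
      have hsub : nbr (tr M) (X' \ X) W ⊆ nbr (tr M) (insert w (X' \ X)) W :=
        nbr_mono (subset_insert _ _) le_rfl
      have hsub' := card_le_card hsub
      have hk := card_sdiff_add_card_eq_card (nbr_subset (M := tr M) (B := X' \ X) (W := W))
      rcases ((X' \ X) \ nbr (tr M) (X' \ X) W).eq_empty_or_nonempty with h0 | h0
      · have h1 := card_le_card hW
        rw [h0, card_empty, zero_add] at hk
        -- Only for `W = Y \ Y'` can the intermediate rows fail to supply the surplus; there `w` is
        -- the extra neighbour.
        by_cases hWe : W.card = (Y \ Y').card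
        · have hWY : W = Y \ Y' := eq_of_subset_of_card_le hW hWe.ge
          have h2 : insert w (nbr (tr M) (X' \ X) W) ⊆ nbr (tr M) (insert w (X' \ X)) W := by
            refine insert_subset (mem_nbr.2 ⟨mem_insert_self _ _, ?_⟩) hsub
            rw [hWY]; exact hwY
          have h3 := card_le_card h2
          rw [card_insert_of_notMem (fun h' => hwD (nbr_subset h'))] at h3
          omega
        · omega
      · have := hC.card_lt h (sdiff_subset (s := X' \ X) (t := nbr (tr M) (X' \ X) W)) hW h0 hWn (by
          intro i hi j hj
          obtain ⟨hi1, hi2⟩ := mem_sdiff.1 hi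
          by_contra hne
          exact hi2 (mem_nbr.2 ⟨hi1, j, hj, hne⟩))
        omega)
  refine ⟨M', ?_, hM, hM'⟩
  have hcut := h.cut hC.sep
  have ht : t ∉ B \ Y := by simp [hC.sep.mem_col]
  refine ⟨?_, disjoint_of_subset_left hC.ssub.1 disjoint_sdiff,
    disjoint_of_subset_right (erase_subset_erase _ hYY) hcut.disj_cols, hcut.card_cols, ?_, ?_, ?_⟩
  · have e1 : insert w (A \ insert w (X' \ X)) = X ∪ A \ X' := by
      ext i
      have hXX := hC.ssub.1
      have h1 := @hXX i
      have h2 := @hXA i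
      have h3 : i = w → i ∈ A ∧ i ∉ X' := by rintro rfl; exact mem_sdiff.1 hw
      simp only [mem_insert, mem_sdiff, mem_union]; tauto
    have e2 : B \ (Y \ Y') = insert t (B \ Y) ∪ Y'.erase t := by
      ext j
      have h1 := @hYY j
      have h2 := @hYB j
      have h3 : j = t → j ∈ Y' := by rintro rfl; exact hC.sep'.mem_col
      simp only [mem_insert, mem_sdiff, mem_union, mem_erase]; tauto
    rw [e1, e2] at hG
    exact hG
  · rw [hC.sep'.card_sdiff_rows, ← card_erase_add_one hC.sep'.mem_col]
  · intro z hz z' hz' hne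
    refine (hcut.pm_left z hz z' hz' hne).congr fun i hi j _ hij => ?_
    rwa [hM i j (by rintro rfl; exact hwX hi)]
  · intro y hy y' hy' hne
    refine (h.pm_right hC.sep' hy hy' hne).congr fun i hi j _ hij => ?_
    by_cases hiw : i = w
    · subst hiw
      exact (hM' j).2 ⟨i, mem_insert_self _ _, hij⟩
    · rwa [hM i j hiw]

/-! ### Edges crossing consecutive separations. -/

lemma SB.two_le_card_nbr_col {A B : Finset V} {M : V → V → ℝ} (h : SB A B M) {u t : V}
    {X Y : Finset V} (hS : Sep A B M u t X Y) : 2 ≤ (nbr (tr M) (A \ X) {t}).card := by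
  have h3 := h.three_le
  have h1 := h.card_nbr_tr (W := {t}) (singleton_subset_iff.2 (hS.cols hS.mem_col))
    (singleton_nonempty t) (by rw [card_singleton]; exact h3)
  have h2 : nbr (tr M) A {t} ⊆ insert u (nbr (tr M) (A \ X) {t}) := by
    intro i hi
    obtain ⟨hiA, j, hj, hij⟩ := mem_nbr.1 hi
    rw [mem_singleton] at hj; subst hj
    by_cases hiX : i ∈ X
    · rw [(hS.edge i hiX j hS.mem_col hij).1]; exact mem_insert_self _ _
    · exact mem_insert_of_mem (mem_nbr.2 ⟨mem_sdiff.2 ⟨hiA, hiX⟩, j, by simp, hij⟩)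
  have h4 := card_le_card h2
  have h5 := card_insert_le u (nbr (tr M) (A \ X) {t})
  rw [card_singleton] at h1
  omega

/-- The columns `Y \ Y'` have surplus two in `A`. Apart from the equally many rows `X' \ X`, all
their neighbours lie in `A \ X'`. -/
lemma Cov.two_le_card_nbr {A B : Finset V} {M : V → V → ℝ} {u t : V} {X Y X' Y' : Finset V}
    (hC : Cov A B M u t X Y X' Y') (h : SB A B M) :
    2 ≤ (nbr (tr M) (A \ X') (Y \ Y')).card := by
  have c1 := hC.card_rows
  have c2 := hC.card_cols h
  have c3 := hC.sep.card
  have c4 := hC.sep'.card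
  have c7 := card_pos.2 ⟨u, hC.sep.mem_row⟩
  have c8 := card_pos.2 ⟨t, hC.sep'.mem_col⟩
  have c9 := card_lt_card hC.ssub
  have h1 := h.card_nbr_tr (W := Y \ Y') (sdiff_subset.trans hC.sep.cols) (card_pos.1 (by omega))
    (by omega)
  have h2 : nbr (tr M) A (Y \ Y') ⊆ (X' \ X) ∪ nbr (tr M) (A \ X') (Y \ Y') := by
    intro i hi
    obtain ⟨hiA, j, hj, hij⟩ := mem_nbr.1 hi
    by_cases hiX' : i ∈ X'
    · refine mem_union_left _ (mem_sdiff.2 ⟨hiX', fun hiX => ?_⟩)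
      obtain ⟨-, rfl⟩ := hC.sep.edge i hiX j (mem_sdiff.1 hj).1 hij
      exact (mem_sdiff.1 hj).2 hC.sep'.mem_col
    · exact mem_union_right _ (mem_nbr.2 ⟨mem_sdiff.2 ⟨hiA, hiX'⟩, j, hj, hij⟩)
  have h4 := card_le_card h2
  have h5 := card_union_le (X' \ X) (nbr (tr M) (A \ X') (Y \ Y'))
  omega

/-- At most two columns outside `Y` are adjacent both to the rows added and to the rows left. -/
lemma Cov.card_common_le_two {A B : Finset V} {M : V → V → ℝ} {u t : V} {X Y X' Y' : Finset V}
    (hC : Cov A B M u t X Y X' Y') (h : SB A B M) :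
    (nbr M (B \ Y) (X' \ X) ∩ nbr M (B \ Y) (A \ X')).card ≤ 2 := by
  by_contra hlt
  obtain ⟨z, hzmem, hzinj⟩ : ∃ z : Fin 3 → V,
      (∀ i, z i ∈ nbr M (B \ Y) (X' \ X) ∩ nbr M (B \ Y) (A \ X')) ∧ Function.Injective z := by
    obtain ⟨S, hS, hS3⟩ := exists_subset_card_eq (Nat.lt_of_not_le hlt)
    let e := S.equivFinOfCardEq hS3
    exact ⟨fun i => (e.symm i : V), fun i => hS (e.symm i).2,
      Subtype.val_injective.comp e.symm.injective⟩
  have hzne : ∀ i j, i ≠ j → z i ≠ z j := fun i j hij h' => hij (hzinj h')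
  have hzB : ∀ i, z i ∈ B \ Y := fun i => (mem_nbr.1 (mem_inter.1 (hzmem i)).1).1
  have hzX : ∀ i, ∃ y ∈ X' \ X, M y (z i) ≠ 0 := fun i =>
    (mem_nbr.1 (mem_inter.1 (hzmem i)).1).2
  have hzC : ∀ i, ∃ y ∈ A \ X', M y (z i) ≠ 0 := fun i =>
    (mem_nbr.1 (mem_inter.1 (hzmem i)).2).2
  have hzT : ∀ i, z i ∈ insert t (B \ Y) := fun i => mem_insert_of_mem (hzB i)
  have htT : t ∈ insert t (B \ Y) := mem_insert_self _ _
  have hzt : ∀ i, z i ≠ t := fun i h' => (mem_sdiff.1 (hzB i)).2 (h' ▸ hC.sep.mem_col)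
  have hCR : A \ X' ⊆ A \ X := sdiff_subset_sdiff le_rfl hC.ssub.1
  have htX : ∀ i ∈ X' \ X, M i t = 0 := by
    intro i hi
    by_contra hne
    have := (hC.sep'.edge i (mem_sdiff.1 hi).1 t hC.sep'.mem_col hne).1
    exact (mem_sdiff.1 hi).2 (this ▸ hC.sep.mem_row)
  have hMt : ∀ {w : V} {M' : V → V → ℝ},
      (∀ j, M' w j ≠ 0 ↔ ∃ y ∈ insert w (X' \ X), M y j ≠ 0) → M w t ≠ 0 → M' w t ≠ 0 :=
    fun hM' hw => (hM' t).2 ⟨_, mem_insert_self _ _, hw⟩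
  -- the rows adjacent to the new columns, and to `t`
  have hV := h.two_le_card_nbr_col hC.sep'
  have hW := hC.two_le_card_nbr h
  have hVother : ∀ w, ∃ v ∈ A \ X', v ≠ w ∧ M v t ≠ 0 := by
    intro w
    obtain ⟨v, hv, hvw⟩ := exists_mem_ne (Nat.lt_of_succ_le hV) w
    obtain ⟨hv1, j, hj, hj'⟩ := mem_nbr.1 hv
    rw [mem_singleton] at hj; subst hj
    exact ⟨v, hv1, hvw, hj'⟩
  have hcut := h.cut hC.sep
  by_cases hex : ∃ w ∈ A \ X', (∃ j ∈ Y \ Y', M w j ≠ 0) ∧ M w t ≠ 0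
  · obtain ⟨w, hw, hwY, hwt⟩ := hex
    obtain ⟨M', hcut', hM, hM'⟩ := hC.exists_cut h hw hwY
    obtain ⟨v, hv, hvw, hvt⟩ := hVother w
    have hMz : ∀ i, M' w (z i) ≠ 0 := by
      intro i
      obtain ⟨y, hy, hy'⟩ := hzX i
      exact (hM' _).2 ⟨y, mem_insert_of_mem hy, hy'⟩
    -- In the contracted cut `w` meets `t` and every `z i`, so at most one `z i` has another
    -- neighbour in `A \ X'`.
    have claim : ∀ i j, i ≠ j → (∃ y ∈ A \ X', y ≠ w ∧ M y (z i) ≠ 0) →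
        (∃ y ∈ A \ X', y ≠ w ∧ M y (z j) ≠ 0) → False := by
      rintro i j hij ⟨y, hy, hyw, hyz⟩ ⟨y', hy', hyw', hyz'⟩
      refine hcut'.row_branch hw (z := ![t, z i, z j]) (y' := ![v, y, y']) ?_ ?_ ?_ ?_ ?_ ?_
      · intro k; fin_cases k <;> simp [hzB]
      · intro k l hkl
        fin_cases k <;> fin_cases l <;> first | exact absurd rfl hkl | skip
        all_goals simp [hzt, (hzt _).symm, hzne i j hij, (hzne i j hij).symm]
      · intro k; fin_cases k
        · exact hMt hM' hwt
        · exact hMz i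
        · exact hMz j
      · intro k; fin_cases k <;> assumption
      · intro k; fin_cases k
        · exact hvw.symm
        · exact hyw.symm
        · exact hyw'.symm
      · intro k; fin_cases k
        · change M' v t ≠ 0; rwa [hM _ _ hvw]
        · change M' y (z i) ≠ 0; rwa [hM _ _ hyw]
        · change M' y' (z j) ≠ 0; rwa [hM _ _ hyw']
    -- In the original cut the further neighbours of `z i`, `z j` are rows of `X' \ X`, and `t` is
    -- the third branch at `w`.
    have claim2 : ∀ i j, i ≠ j → M w (z i) ≠ 0 → M w (z j) ≠ 0 → False := by
      intro i j hij hi hj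
      obtain ⟨y, hy, hyz⟩ := hzX i
      obtain ⟨y', hy', hyz'⟩ := hzX j
      have hwX' := (mem_sdiff.1 hw).2
      have hne : ∀ y ∈ X' \ X, w ≠ y := by
        rintro y hy rfl; exact hwX' (mem_sdiff.1 hy).1
      have hDR : X' \ X ⊆ A \ X := sdiff_subset_sdiff hC.sep'.rows le_rfl
      refine hcut.row_branch (hCR hw) (z := ![t, z i, z j]) (y' := ![v, y, y']) ?_ ?_ ?_ ?_ ?_ ?_
      · intro k; fin_cases k <;> simp [hzB]
      · intro k l hkl
        fin_cases k <;> fin_cases l <;> first | exact absurd rfl hkl | skip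
        all_goals simp [hzt, (hzt _).symm, hzne i j hij, (hzne i j hij).symm]
      · intro k; fin_cases k <;> assumption
      · intro k; fin_cases k
        · exact hCR hv
        · exact hDR hy
        · exact hDR hy'
      · intro k; fin_cases k
        · exact hvw.symm
        · exact hne _ hy
        · exact hne _ hy'
      · intro k; fin_cases k <;> assumption
    have hcase : ∀ i, (∃ y ∈ A \ X', y ≠ w ∧ M y (z i) ≠ 0) ∨ M w (z i) ≠ 0 := by
      intro i
      obtain ⟨y, hy, hyz⟩ := hzC i
      by_cases hyw : y = w
      · right; rwa [← hyw]
      · left; exact ⟨y, hy, hyw, hyz⟩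
    rcases hcase 0 with h0 | h0 <;> rcases hcase 1 with h1 | h1 <;> rcases hcase 2 with h2 | h2
    · exact claim 0 1 (by decide) h0 h1
    · exact claim 0 1 (by decide) h0 h1
    · exact claim 0 2 (by decide) h0 h2
    · exact claim2 1 2 (by decide) h1 h2
    · exact claim 1 2 (by decide) h1 h2
    · exact claim2 0 2 (by decide) h0 h2
    · exact claim2 0 1 (by decide) h0 h1
    · exact claim2 0 1 (by decide) h0 h1
  · push Not at hex
    have honly : ∀ w ∈ A \ X', (∃ j ∈ Y \ Y', M w j ≠ 0) →
        ∃ i, ∀ y ∈ A \ X', M y (z i) ≠ 0 → y = w := by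
      intro w hw hwY
      by_contra! hc
      choose y hy hyz hyw using hc
      obtain ⟨M', hcut', hM, hM'⟩ := hC.exists_cut h hw hwY
      refine hcut'.row_branch hw hzT hzne (fun i => ?_) hy (fun i => (hyw i).symm) (fun i => ?_)
      · obtain ⟨y, hy, hy'⟩ := hzX i
        exact (hM' _).2 ⟨y, mem_insert_of_mem hy, hy'⟩
      · rw [hM _ _ (hyw i)]; exact hyz i
    obtain ⟨w₁, hw₁, w₂, hw₂, hw12⟩ := one_lt_card.1 (Nat.lt_of_succ_le hW)
    obtain ⟨hw₁, hw₁Y⟩ := mem_nbr.1 hw₁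
    obtain ⟨hw₂, hw₂Y⟩ := mem_nbr.1 hw₂
    obtain ⟨i₁, hi₁⟩ := honly w₁ hw₁ hw₁Y
    obtain ⟨i₂, hi₂⟩ := honly w₂ hw₂ hw₂Y
    obtain ⟨l, hl⟩ : ∃ l : Fin 3, ∀ k, k = i₁ ∨ k = i₂ ∨ k = l := by
      have hne : i₁ ≠ i₂ := by
        rintro rfl
        obtain ⟨y, hy, hyz⟩ := hzC i₁
        exact hw12 ((hi₁ y hy hyz).symm.trans (hi₂ y hy hyz))
      revert i₁ i₂; intro i₁ _ i₂ _ hne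
      clear * - hne
      revert hne; revert i₁ i₂; decide
    -- `v` is chosen so that every `z i` keeps a neighbour `ρ i` different from `v`; then `(v, t)`
    -- can serve as the fixed edge of `exists_comonotone`.
    obtain ⟨v, hv, hvt, hvl⟩ : ∃ v ∈ A \ X', M v t ≠ 0 ∧
        ∃ y ∈ A \ X', y ≠ v ∧ M y (z l) ≠ 0 := by
      obtain ⟨y, hy, hyz⟩ := hzC l
      obtain ⟨v, hv, hvy, hvt⟩ := hVother y
      exact ⟨v, hv, hvt, y, hy, hvy.symm, hyz⟩
    have hρ : ∀ i, ∃ y ∈ A \ X', y ≠ v ∧ M y (z i) ≠ 0 := by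
      intro i
      rcases hl i with rfl | rfl | rfl
      · obtain ⟨y, hy, hyz⟩ := hzC i
        refine ⟨y, hy, ?_, hyz⟩
        rw [hi₁ y hy hyz]; rintro rfl; exact hvt (hex w₁ hw₁ hw₁Y)
      · obtain ⟨y, hy, hyz⟩ := hzC i
        refine ⟨y, hy, ?_, hyz⟩
        rw [hi₂ y hy hyz]; rintro rfl; exact hvt (hex w₂ hw₂ hw₂Y)
      · exact hvl
    choose ρ hρC hρv hρz using hρ
    obtain ⟨p, q, hpq, hpt⟩ := hcut.exists_spans (y := v) (z := t) (y' := ρ 0) (z' := z 0)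
      ⟨hCR hv, htT, hCR (hρC 0), hzT 0, (hρv 0).symm, (hzt 0).symm, hvt, hρz 0⟩ htT
    -- No `z i` has the middle value of `q / p`: after contraction into some `w ≠ ρ i`, the
    -- difference to any other `z j` has the sign of `b w - b (ρ i)`. The pair `p`, `q` serves for
    -- every `w`, as the rows `X` are unchanged.
    have hfin : ∀ i j k : Fin 3, i ≠ j → i ≠ k →
        0 < (q (z j) / p (z j) - q (z i) / p (z i)) * (q (z k) / p (z k) - q (z i) / p (z i)) := by
      intro i j k hij hik
      obtain ⟨w, hw, hwY, hwρ⟩ : ∃ w ∈ A \ X', (∃ j ∈ Y \ Y', M w j ≠ 0) ∧ w ≠ ρ i := by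
        by_cases hw : w₁ = ρ i
        · exact ⟨w₂, hw₂, hw₂Y, fun h' => hw12 (hw.trans h'.symm)⟩
        · exact ⟨w₁, hw₁, hw₁Y, hw⟩
      have hwv : v ≠ w := by rintro rfl; exact hvt (hex v hw hwY)
      obtain ⟨M', hcut', hM, hM'⟩ := hC.exists_cut h hw hwY
      have hspan : Spans X (insert t (B \ Y)) M' p q := by
        intro x hx
        refine hpq x fun i hi => ?_
        rw [← hx i hi]
        refine sum_congr rfl fun j _ => ?_
        rw [hM i j (by rintro rfl; exact (mem_sdiff.1 hw).2 (hC.ssub.1 hi))]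
      obtain ⟨b, hb⟩ := hcut'.exists_comonotone hspan htT hv hpt
        (by rwa [hM _ _ hwv])
      have hMz : ∀ i, M' w (z i) ≠ 0 := by
        intro i
        obtain ⟨y, hy, hy'⟩ := hzX i
        exact (hM' _).2 ⟨y, mem_insert_of_mem hy, hy'⟩
      have hbj : ∀ j, i ≠ j → 0 < (q (z j) / p (z j) - q (z i) / p (z i)) * (b w - b (ρ i)) := by
        intro j hij
        refine hb _ _ _ _ ⟨mem_erase.2 ⟨hρv i, hρC i⟩, mem_erase.2 ⟨hzt i, hzT i⟩,
          mem_erase.2 ⟨hwv.symm, hw⟩, mem_erase.2 ⟨hzt j, hzT j⟩, hwρ.symm, hzne i j hij, ?_, hMz j⟩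
        rw [hM _ _ hwρ.symm]; exact hρz i
      have h1 := mul_pos (hbj j hij) (hbj k hik)
      have h2 : (q (z j) / p (z j) - q (z i) / p (z i)) * (b w - b (ρ i)) *
          ((q (z k) / p (z k) - q (z i) / p (z i)) * (b w - b (ρ i))) =
          (q (z j) / p (z j) - q (z i) / p (z i)) * (q (z k) / p (z k) - q (z i) / p (z i))
            * (b w - b (ρ i)) ^ 2 := by ring
      rw [h2] at h1
      exact pos_of_mul_pos_left h1 (sq_nonneg _)
    have f0 := hfin 0 1 2 (by decide) (by decide)
    have f1 := hfin 1 0 2 (by decide) (by decide)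
    have f2 := hfin 2 0 1 (by decide) (by decide)
    generalize q (z 0) / p (z 0) = a0 at *
    generalize q (z 1) / p (z 1) = a1 at *
    generalize q (z 2) / p (z 2) = a2 at *
    -- One of three reals lies between the others: the product of the three conditions is minus a
    -- square.
    have h1 := mul_pos (mul_pos f0 f1) f2
    have h2 : (a1 - a0) * (a2 - a0) * ((a0 - a1) * (a2 - a1)) * ((a0 - a2) * (a1 - a2))
      = -((a1 - a0) * (a2 - a0) * (a2 - a1)) ^ 2 := by ring
    rw [h2] at h1
    have := sq_nonneg ((a1 - a0) * (a2 - a0) * (a2 - a1))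
    linarith

/-- The edges of a cut that avoid the ends of one of its edges form a forest. -/
lemma Cut.ec_add_one_le {X R T Q : Finset V} {M : V → V → ℝ} (h : Cut X R T Q M) {v t : V}
    (hv : v ∈ R) (ht : t ∈ T) (hvt : M v t ≠ 0) {R' T' : Finset V} (hR : R' ⊆ R.erase v)
    (hT : T' ⊆ T.erase t) (hpos : 0 < ec M R' T') :
    ec M R' T' + 1 ≤ (nbr (tr M) R' T').card + (nbr M T' R').card := by
  have hmem : ∀ e : V × V, e ∈ (R' ×ˢ T').filter (fun p => M p.1 p.2 ≠ 0) ↔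
      e.1 ∈ R' ∧ e.2 ∈ T' ∧ M e.1 e.2 ≠ 0 := by
    intro e; simp only [mem_filter, mem_product, and_assoc]
  have hE := card_pos.1 hpos
  obtain ⟨e₀, he₀⟩ := hE
  obtain ⟨h1, h2, h3⟩ := (hmem e₀).1 he₀
  have h1' := mem_erase.1 (hR h1)
  have h2' := mem_erase.1 (hT h2)
  obtain ⟨p, q, hpq, hpt⟩ := h.exists_spans
    ⟨hv, ht, h1'.2, h2'.2, h1'.1.symm, h2'.1.symm, hvt, h3⟩ ht
  obtain ⟨b, hb⟩ := h.exists_comonotone hpq ht hv hpt hvt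
  have key := card_add_one_le_of_comonotone (a := fun z => q z / p z) (b := b) _ ⟨e₀, he₀⟩ (by
    intro e he e' he' hne hne'
    obtain ⟨h4, h5, h6⟩ := (hmem e).1 he
    obtain ⟨h7, h8, h9⟩ := (hmem e').1 he'
    exact hb _ _ _ _ ⟨hR h4, hT h5, hR h7, hT h8, hne, hne', h6, h9⟩)
  refine key.trans (add_le_add (card_le_card ?_) (card_le_card ?_))
  · intro y hy
    obtain ⟨e, he, rfl⟩ := mem_image.1 hy
    obtain ⟨h4, h5, h6⟩ := (hmem e).1 he
    exact mem_nbr.2 ⟨h4, e.2, h5, h6⟩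
  · intro y hy
    obtain ⟨e, he, rfl⟩ := mem_image.1 hy
    obtain ⟨h4, h5, h6⟩ := (hmem e).1 he
    exact mem_nbr.2 ⟨h5, e.1, h4, h6⟩

lemma SB.exists_col_nbr {A B : Finset V} {M : V → V → ℝ} (h : SB A B M) {u t : V}
    {X Y : Finset V} (hS : Sep A B M u t X Y) (w : V) : ∃ v ∈ A \ X, v ≠ w ∧ M v t ≠ 0 := by
  obtain ⟨v, hv, hvw⟩ := exists_mem_ne (Nat.lt_of_succ_le (h.two_le_card_nbr_col hS)) w
  obtain ⟨hv1, j, hj, hj'⟩ := mem_nbr.1 hv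
  rw [mem_singleton] at hj; subst hj
  exact ⟨v, hv1, hvw, hj'⟩

/-- These edges avoid `t` and a neighbour `v` of `t` in `A \ X'`, so they form a forest. At most two
of its columns are shared with `A \ X'`, and the forest bound saves one. -/
lemma Cov.ec_outer {A B : Finset V} {M : V → V → ℝ} {u t : V} {X Y X' Y' : Finset V}
    (hC : Cov A B M u t X Y X' Y') (h : SB A B M) :
    ec M (X' \ X) (B \ Y) ≤ (nbr (tr M) (X' \ X) (B \ Y)).card
      + (nbr M (B \ Y) (X' \ X) \ nbr M (B \ Y) (A \ X')).card
      + (if (nbr M (B \ Y) (A \ X')).Nonempty then 1 else 0) := by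
  rcases Nat.eq_zero_or_pos (ec M (X' \ X) (B \ Y)) with h0 | hpos
  · omega
  obtain ⟨v, hv, -, hvt⟩ := h.exists_col_nbr hC.sep' u
  have hvX := mem_sdiff.1 hv
  have h1 := (h.cut hC.sep).ec_add_one_le (v := v) (t := t)
    (mem_sdiff.2 ⟨hvX.1, fun h' => hvX.2 (hC.ssub.1 h')⟩) (mem_insert_self _ _) hvt
    (R' := X' \ X) (T' := B \ Y) (by
      intro i hi
      obtain ⟨hi1, hi2⟩ := mem_sdiff.1 hi
      exact mem_erase.2 ⟨by rintro rfl; exact hvX.2 hi1, mem_sdiff.2 ⟨hC.sep'.rows hi1, hi2⟩⟩) (by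
      intro j hj
      exact mem_erase.2 ⟨by rintro rfl; exact (mem_sdiff.1 hj).2 hC.sep.mem_col,
        mem_insert_of_mem hj⟩) hpos
  have h2 := hC.card_common_le_two h
  have h3 := card_sdiff_add_card_inter (nbr M (B \ Y) (X' \ X)) (nbr M (B \ Y) (A \ X'))
  split_ifs with h4
  · omega
  · rw [not_nonempty_iff_eq_empty] at h4
    rw [h4, inter_empty, card_empty] at h3
    rw [h4]
    omega

/-- The column and corner terms of `ec_piece` cancel those of `ec_outer`. Columns that lose their
last neighbour among the remaining rows leave the second term of the invariant, which pays for the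
rest. -/
lemma Cov.bound_step {A B : Finset V} {M : V → V → ℝ} {u t : V} {X Y X' Y' : Finset V}
    (hC : Cov A B M u t X Y X' Y') (h : SB A B M) (ih : EdgeBoundBelow V A.card)
    (hX : ec M X (B \ Y) + (nbr M (B \ Y) (A \ X)).card ≤ 4 * X.card) :
    ec M X' (B \ Y') + (nbr M (B \ Y') (A \ X')).card ≤ 4 * X'.card := by
  have h1 := hC.ec_piece h ih
  have h2 := hC.ec_outer h
  have hYY := hC.cols_subset h
  have hYB := hC.sep.cols
  have hXX := hC.ssub.1
  have hX'A := hC.sep'.rows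
  have e1 : B \ Y' = (B \ Y) ∪ (Y \ Y') := by
    ext j
    have h1 := @hYY j
    have h2 := @hYB j
    simp only [mem_sdiff, mem_union]; tauto
  have d1 : Disjoint (B \ Y) (Y \ Y') :=
    disjoint_of_subset_right sdiff_subset sdiff_disjoint
  have e2 : X' = X ∪ (X' \ X) := (union_sdiff_of_subset hXX).symm
  have e3 : A \ X = (X' \ X) ∪ (A \ X') := by
    ext j
    have h1 := @hXX j
    have h2 := @hX'A j
    simp only [mem_sdiff, mem_union]; tauto
  have d2 : Disjoint X (X' \ X) := disjoint_sdiff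
  have c1 := hC.card_rows
  have z1 : ec M X (Y \ Y') = 0 := ec_eq_zero (by
    intro i hi j hj
    by_contra hne
    obtain ⟨-, rfl⟩ := hC.sep.edge i hi j (mem_sdiff.1 hj).1 hne
    exact (mem_sdiff.1 hj).2 hC.sep'.mem_col)
  have k1 : ec M X' (B \ Y') = ec M X (B \ Y) + ec M (X' \ X) (B \ Y)
      + ec M (X' \ X) (Y \ Y') := by
    rw [e1, ec_union_right _ d1]
    conv_lhs => rw [e2]
    rw [ec_union_left _ d2, ec_union_left _ d2, z1]
    omega
  have k2 : (nbr M (B \ Y') (A \ X')).card = (nbr M (B \ Y) (A \ X')).card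
      + (nbr M (Y \ Y') (A \ X')).card := by
    rw [e1, nbr, filter_union, card_union_of_disjoint]
    · rfl
    · exact disjoint_filter_filter d1
  have k3 : (nbr M (B \ Y) (A \ X)).card = (nbr M (B \ Y) (A \ X')).card
      + (nbr M (B \ Y) (X' \ X) \ nbr M (B \ Y) (A \ X')).card := by
    have : nbr M (B \ Y) (A \ X) = nbr M (B \ Y) (A \ X') ∪ nbr M (B \ Y) (X' \ X) := by
      ext j
      simp only [mem_nbr, mem_union, e3]
      constructor
      · rintro ⟨hj, i, hi | hi, hij⟩
        · exact Or.inr ⟨hj, i, hi, hij⟩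
        · exact Or.inl ⟨hj, i, hi, hij⟩
      · rintro (⟨hj, i, hi, hij⟩ | ⟨hj, i, hi, hij⟩)
        · exact ⟨hj, i, Or.inr hi, hij⟩
        · exact ⟨hj, i, Or.inl hi, hij⟩
    rw [this, ← union_sdiff_self_eq_union, card_union_of_disjoint disjoint_sdiff]
  omega

/-- Edges between the two complements of a separation. -/
lemma SB.ec_compl_lt {A B : Finset V} {M : V → V → ℝ} (h : SB A B M) {u t : V} {X Y : Finset V}
    (hS : Sep A B M u t X Y) :
    ec M (A \ X) (B \ Y) + 1 ≤ (nbr M (B \ Y) (A \ X)).card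
      + (nbr (tr M) (A \ X) (B \ Y)).card := by
  obtain ⟨v, hv, -, hvt⟩ := h.exists_col_nbr hS u
  obtain ⟨v', hv', hvv', hvt'⟩ := h.exists_col_nbr hS v
  have c1 := hS.card_sdiff_rows
  have c2 := hS.card_sdiff_cols h.card_eq
  have c3 := hS.card
  have c4 := card_pos.2 ⟨u, hS.mem_row⟩
  have c5 := card_pos.2 ⟨t, hS.mem_col⟩
  have hcut := h.cut hS
  set R := (A \ X).erase v with hR
  set T := B \ Y with hT
  have hv0 : v ∉ R := by simp [hR]
  have hRv : insert v R = A \ X := insert_erase hv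
  have htT : ∀ j ∈ T, j ≠ t := by
    rintro j hj rfl; exact (mem_sdiff.1 hj).2 hS.mem_col
  have hpos : 0 < ec M R T := by
    by_contra h0
    have hz : ∀ i ∈ R, ∀ j ∈ T, M i j = 0 := by
      intro i hi j hj
      by_contra hne
      exact h0 (card_pos.2 ⟨(i, j), mem_filter.2 ⟨mem_product.2 ⟨hi, hj⟩, hne⟩⟩)
    have h1 := h.brace R ((erase_subset _ _).trans sdiff_subset) T sdiff_subset
      ⟨v', mem_erase.2 ⟨hvv', hv'⟩⟩ (card_pos.1 (by omega)) hz
    have h2 : R.card + 1 = (A \ X).card := card_erase_add_one hv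
    omega
  have hfor := hcut.ec_add_one_le hv (mem_insert_self _ _) hvt (R' := R) (T' := T) le_rfl
    (fun j hj => mem_erase.2 ⟨htT j hj, mem_insert_of_mem hj⟩) hpos
  have k1 : ec M (A \ X) T = ec M R T + (nbr M T {v}).card := by
    rw [← hRv, ec_insert_left _ hv0]
  have k2 : nbr (tr M) R T ⊆ nbr (tr M) (A \ X) T := nbr_mono (erase_subset _ _) le_rfl
  have k3 : nbr M T R ⊆ nbr M T (A \ X) := nbr_mono le_rfl (erase_subset _ _)
  have k4 : nbr M T {v} ⊆ nbr M T (A \ X) := nbr_mono le_rfl (singleton_subset_iff.2 hv)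
  rcases (nbr M T {v}).eq_empty_or_nonempty with h0 | ⟨j₀, hj₀⟩
  · rw [h0, card_empty] at k1
    have := card_le_card k2
    have := card_le_card k3
    omega
  · have k5 : insert v (nbr (tr M) R T) ⊆ nbr (tr M) (A \ X) T := by
      refine insert_subset ?_ k2
      obtain ⟨hj, i, hi, hij⟩ := mem_nbr.1 hj₀
      rw [mem_singleton] at hi; subst hi
      exact mem_nbr.2 ⟨hv, j₀, hj, hij⟩
    have k6 := card_le_card k5
    rw [card_insert_of_notMem (fun h' => hv0 (nbr_subset h'))] at k6
    -- Two shared columns together with `t` would be three branches at `v`. Hence putting row `v`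
    -- back preserves the forest count.
    have k7 : (nbr M T {v} ∩ nbr M T R).card ≤ 1 := by
      by_contra hlt
      obtain ⟨z, hz, z', hz', hzz⟩ := one_lt_card.1 (Nat.lt_of_not_le hlt)
      have prop : ∀ z ∈ nbr M T {v} ∩ nbr M T R, z ∈ T ∧ M v z ≠ 0 ∧
          ∃ y ∈ A \ X, v ≠ y ∧ M y z ≠ 0 := by
        intro z hz
        obtain ⟨h1, h2⟩ := mem_inter.1 hz
        obtain ⟨h3, i, hi, hij⟩ := mem_nbr.1 h1
        rw [mem_singleton] at hi; subst hi
        obtain ⟨-, y, hy, hyz⟩ := mem_nbr.1 h2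
        obtain ⟨h4, h5⟩ := mem_erase.1 hy
        exact ⟨h3, hij, y, h5, h4.symm, hyz⟩
      obtain ⟨h1, h2, y, hy, hvy, hyz⟩ := prop z hz
      obtain ⟨h1', h2', y', hy', hvy', hyz'⟩ := prop z' hz'
      have e1 := htT z h1
      have e2 := htT z' h1'
      refine hcut.row_branch hv (z := ![t, z, z']) (y' := ![v', y, y']) ?_ ?_ ?_ ?_ ?_ ?_
      · intro k; fin_cases k <;> simp [h1, h1']
      · intro k l hkl
        fin_cases k <;> fin_cases l <;> first | exact absurd rfl hkl | skip
        all_goals simp [e1, e1.symm, e2, e2.symm, hzz, hzz.symm]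
      · intro k; fin_cases k <;> assumption
      · intro k; fin_cases k <;> assumption
      · intro k; fin_cases k
        · exact hvv'.symm
        · exact hvy
        · exact hvy'
      · intro k; fin_cases k <;> assumption
    have k8 := card_le_card (union_subset k4 k3)
    have k9 := card_union_add_card_inter (nbr M T {v}) (nbr M T R)
    omega

/-! ### The edge bound for braces. -/

/-- The edge bound in the presence of a separation. -/
lemma SB.ec_le_of_sep {A B : Finset V} {M : V → V → ℝ} (h : SB A B M)
    (ih : EdgeBoundBelow V A.card) {u t : V} {X₀ Y₀ : Finset V} (hS₀ : Sep A B M u t X₀ Y₀) :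
    ec M A B + 4 ≤ 4 * A.card := by
  have hAB := h.card_eq
  -- a minimal separation
  obtain ⟨X₁, hX₁, hmin⟩ := exists_min_image (A.powerset.filter fun X => ∃ Y, Sep A B M u t X Y)
    card ⟨X₀, mem_filter.2 ⟨mem_powerset.2 hS₀.rows, Y₀, hS₀⟩⟩
  obtain ⟨-, Y₁, hS₁⟩ := mem_filter.1 hX₁
  have hb₁ := h.ec_le_of_minimal ih hS₁ (by
    intro X' Y' hS' hX'
    exact eq_of_subset_of_card_le hX' (hmin X' (mem_filter.2 ⟨mem_powerset.2 hS'.rows, Y', hS'⟩)))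
  -- a largest separation satisfying the bound
  obtain ⟨X, hX, hmax⟩ := exists_max_image (A.powerset.filter fun X => ∃ Y, Sep A B M u t X Y ∧
    ec M X (B \ Y) + (nbr M (B \ Y) (A \ X)).card ≤ 4 * X.card)
    card ⟨X₁, mem_filter.2 ⟨mem_powerset.2 hS₁.rows, Y₁, hS₁, hb₁⟩⟩
  obtain ⟨-, Y, hS, hb⟩ := mem_filter.1 hX
  have hXmax : ∀ X' Y', Sep A B M u t X' Y' → X ⊆ X' → X' = X := by
    by_contra! hc
    obtain ⟨X', Y', hS', hXX', hne⟩ := hc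
    obtain ⟨X₂, hX₂, hmin₂⟩ := exists_min_image
      (A.powerset.filter fun X' => X ⊂ X' ∧ ∃ Y, Sep A B M u t X' Y) card
      ⟨X', mem_filter.2 ⟨mem_powerset.2 hS'.rows, hXX'.ssubset_of_ne hne.symm, Y', hS'⟩⟩
    obtain ⟨-, hss, Y₂, hS₂⟩ := mem_filter.1 hX₂
    have hcov : Cov A B M u t X Y X₂ Y₂ := by
      refine ⟨hS, hS₂, hss, fun X'' Y'' hS'' h1 h2 => ?_⟩
      by_cases he : X'' = X
      · exact Or.inl he
      · exact Or.inr (eq_of_subset_of_card_le h2 (hmin₂ X'' (mem_filter.2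
          ⟨mem_powerset.2 hS''.rows, h1.ssubset_of_ne (Ne.symm he), Y'', hS''⟩)))
    have h1 := hmax X₂ (mem_filter.2 ⟨mem_powerset.2 hS₂.rows, Y₂, hS₂, hcov.bound_step h ih hb⟩)
    have := card_lt_card hss
    omega
  -- For a maximal `X` the columns `Y` are minimal, so the bound for minimal separations applies to
  -- the transpose.
  have hb' := h.transpose.ec_le_of_minimal (hAB ▸ ih) (hS.transpose hAB) (by
    intro Y' X' hS' hY'
    have hS'' : Sep A B M u t X' Y' := hS'.transpose hAB.symm
    have h1 : X ⊆ X' := h.transpose.sep_anti hS' (hS.transpose hAB) hY'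
    have h2 := hXmax X' Y' hS'' h1
    have h3 := hS.card
    have h4 := hS''.card
    exact eq_of_subset_of_card_le hY' (by rw [h2] at h4; omega))
  rw [ec_tr] at hb'
  have hh := h.ec_compl_lt hS
  have k0 : ec M X Y ≤ 1 := by
    rw [ec, card_le_one]
    intro a ha b hb
    simp only [mem_filter, mem_product] at ha hb
    have h1 := hS.edge _ ha.1.1 _ ha.1.2 ha.2
    have h2 := hS.edge _ hb.1.1 _ hb.1.2 hb.2
    exact Prod.ext (h1.1.trans h2.1.symm) (h1.2.trans h2.2.symm)
  -- The neighbour counts in `hb`, `hb'` and `hh` cancel, leaving `1 + 4 * X.card + 4 * Y.card - 1 =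
  -- 4 * (A.card - 1)`.
  have k1 : ec M A B = ec M X Y + ec M X (B \ Y) + (ec M (A \ X) Y + ec M (A \ X) (B \ Y)) := by
    conv_lhs => rw [← union_sdiff_of_subset hS.rows, ← union_sdiff_of_subset hS.cols]
    rw [ec_union_left _ disjoint_sdiff, ec_union_right _ disjoint_sdiff,
      ec_union_right _ disjoint_sdiff]
  have := hS.card
  omega

lemma Good.erase_edge {A B : Finset V} {M : V → V → ℝ} (h : Good A B M) (u t : V) :
    Good A B (fun i j => if i = u ∧ j = t then 0 else M i j) := by
  intro w hw hPM x hx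
  have e : ∀ i j, w i j * (if i = u ∧ j = t then 0 else M i j)
      = (if i = u ∧ j = t then 0 else w i j) * M i j := by
    intro i j; split_ifs <;> simp
  simp only [e] at hPM hx
  exact h _ (fun i j => by split_ifs <;> simp [hw]) hPM x hx

/-- A sign-nonsingular brace of order `n ≥ 2` has at most `4 n - 4` edges. -/
theorem ec_le_of_brace (n : ℕ) : EdgeBoundBelow V n := by
  induction n with
  | zero => intro A B M h; omega
  | succ n ihn =>
    intro A B M hA h2 hAB hG hB
    rcases (Nat.lt_succ_iff.1 hA).lt_or_eq with hlt | hn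
    · exact ihn A B M hlt h2 hAB hG hB
    rw [← hn] at ihn
    clear hA hn
    generalize hm : ec M A B = m
    induction m using Nat.strong_induction_on generalizing M with
    | _ m ihm =>
    rcases h2.eq_or_lt with h2 | h3
    · have : ec M A B ≤ A.card * B.card := (card_filter_le _ _).trans (card_product _ _).le
      rw [← hAB, ← h2] at this
      omega
    have h : SB A B M := ⟨hG, hB, hAB, h3⟩
    rw [← hm]
    by_cases hex : ∃ u t X Y, Sep A B M u t X Y
    · obtain ⟨u, t, X, Y, hS⟩ := hex
      exact h.ec_le_of_sep ihn hS
    -- otherwise all columns have degree at least four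
    have hdeg : ∀ t ∈ B, 4 ≤ (nbr (tr M) A {t}).card := by
      intro t ht
      by_contra hlt
      have h1 := h.card_nbr_tr (W := {t}) (singleton_subset_iff.2 ht) (singleton_nonempty t)
        (by rw [card_singleton]; exact h3)
      rw [card_singleton] at h1
      obtain ⟨u, hu⟩ := card_pos.1 (show 0 < (nbr (tr M) A {t}).card by omega)
      have hu' := card_erase_add_one hu
      have hsub : (nbr (tr M) A {t}).erase u ⊆ A := (erase_subset _ _).trans nbr_subset
      -- Removing from `A` two of the three neighbours of `t` leaves `A.card - 2` rows, of which
      -- only `u` meets `t`.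
      refine hex ⟨u, t, A \ (nbr (tr M) A {t}).erase u, {t}, sdiff_subset,
        singleton_subset_iff.2 ht, mem_sdiff.2 ⟨nbr_subset hu, by simp⟩, by simp, ?_, ?_⟩
      · intro i hi j hj hij
        rw [mem_singleton] at hj; subst hj
        obtain ⟨hi1, hi2⟩ := mem_sdiff.1 hi
        refine ⟨?_, rfl⟩
        by_contra hne
        exact hi2 (mem_erase.2 ⟨hne, mem_nbr.2 ⟨hi1, j, by simp, hij⟩⟩)
      · have := card_sdiff_add_card_eq_card hsub
        rw [card_singleton]
        omega
    have hbig : 4 * A.card ≤ ec M A B := by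
      rw [hAB, ← ec_tr, ec_eq_sum, mul_comm, ← smul_eq_mul]
      refine card_nsmul_le_sum _ _ _ fun t ht => (hdeg t ht).trans (le_of_eq ?_)
      rw [nbr, card_filter]; simp
    have hpos : 0 < ec M A B := by omega
    obtain ⟨⟨u, t⟩, he⟩ := card_pos.1 hpos
    obtain ⟨he, hut⟩ := mem_filter.1 he
    obtain ⟨hu, ht⟩ := mem_product.1 he
    simp only at hu ht hut
    set M' : V → V → ℝ := fun i j => if i = u ∧ j = t then 0 else M i j with hM'
    have hec : ec M' A B + 1 = ec M A B := by
      have : (A ×ˢ B).filter (fun p => M' p.1 p.2 ≠ 0)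
          = ((A ×ˢ B).filter fun p => M p.1 p.2 ≠ 0).erase (u, t) := by
        ext ⟨i, j⟩
        simp only [hM', mem_filter, mem_erase, mem_product, ne_eq,
          Prod.ext_iff]
        by_cases hij : i = u ∧ j = t <;> simp [hij]
      rw [ec, this]
      exact card_erase_add_one (mem_filter.2 ⟨he, hut⟩)
    -- A violation after deleting `(u, t)` would be a separation. The induction on edges then gives
    -- `ec M A B ≤ 4 * A.card - 3`, against `hbig`.
    have hbr : Brace A B M' := by
      intro P hP L hL hPn hLn hPL
      have hedge : ∀ i ∈ P, ∀ j ∈ L, M i j ≠ 0 → i = u ∧ j = t := by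
        intro i hi j hj hij
        by_contra hne
        have := hPL i hi j hj
        simp only [hM', hne, if_false] at this
        exact hij this
      by_cases hmem : u ∈ P ∧ t ∈ L
      · have h1 := h.card_le_of_edge hP hL hmem.1 hmem.2 hedge
        by_contra hlt
        exact hex ⟨u, t, P, L, hP, hL, hmem.1, hmem.2, hedge, by omega⟩
      · refine h.brace P hP L hL hPn hLn fun i hi j hj => ?_
        by_contra hne
        obtain ⟨rfl, rfl⟩ := hedge i hi j hj hne
        exact hmem ⟨hi, hj⟩
    have := ihm (ec M' A B) (by omega) M' (hG.erase_edge u t) hbr rfl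
    omega

/-! ### From braces to regular graphs. -/

/-- A sign-nonsingular graph in which nonadjacent sets of rows and columns are together smaller
than the order. -/
structure Elementary (A B : Finset V) (M : V → V → ℝ) : Prop where
  good : Good A B M
  card_eq : A.card = B.card
  card_lt : ∀ P ⊆ A, ∀ L ⊆ B, P.Nonempty → L.Nonempty → (∀ i ∈ P, ∀ j ∈ L, M i j = 0) →
    P.card + L.card + 1 ≤ A.card

lemma Elementary.transpose {A B : Finset V} {M : V → V → ℝ} (h : Elementary A B M) :
    Elementary B A (tr M) := by
  refine ⟨h.good.transpose h.card_eq, h.card_eq.symm, fun P hP L hL hPn hLn hPL => ?_⟩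
  have := h.card_lt L hL P hP hLn hPn (fun i hi j hj => hPL j hj i hi)
  have := h.card_eq
  omega

/-- Nonadjacent sets of the largest possible total size. -/
structure Tight (A B : Finset V) (M : V → V → ℝ) (X Y : Finset V) : Prop where
  rows : X ⊆ A
  cols : Y ⊆ B
  rows_ne : X.Nonempty
  cols_ne : Y.Nonempty
  zero : ∀ i ∈ X, ∀ j ∈ Y, M i j = 0
  card : X.card + Y.card + 1 = A.card

lemma Tight.transpose {A B : Finset V} {M : V → V → ℝ} {X Y : Finset V} (h : Tight A B M X Y)
    (hAB : A.card = B.card) : Tight B A (tr M) Y X :=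
  ⟨h.cols, h.rows, h.cols_ne, h.rows_ne, fun i hi j hj => h.zero j hj i hi,
    by have := h.card; omega⟩

/-- Contracting `A \ X` with `Y` gives a brace of order `X.card + 1`, because a violation would be a
tight pair with a side smaller than `X`. Rows of `X` keep degree four and the new row is nonzero:
one edge too many. -/
lemma Elementary.false_of_minimal_tight {A B : Finset V} {M : V → V → ℝ} (h : Elementary A B M)
    (hdeg : ∀ i ∈ A, 4 ≤ (nbr M B {i}).card) {X Y : Finset V} (hT : Tight A B M X Y)
    (hmin : ∀ X' Y', Tight A B M X' Y' → X.card ≤ X'.card ∧ X.card ≤ Y'.card) : False := by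
  have hAB := h.card_eq
  have c1 := card_sdiff_add_card_eq_card hT.rows
  have c2 := card_sdiff_add_card_eq_card hT.cols
  have c3 := hT.card
  have c4 := card_pos.2 hT.rows_ne
  have c5 := card_pos.2 hT.cols_ne
  obtain ⟨c, hc⟩ : (A \ X).Nonempty := card_pos.1 (by omega)
  have hcX : c ∉ X := (mem_sdiff.1 hc).2
  obtain ⟨M', hG, hM1, hM2⟩ := h.good.collapse_rows hAB (sdiff_subset (t := X)) hT.cols
    (by omega) hc (by
      intro W hW hWn
      have hWX : ∀ i ∈ X, ∀ j ∈ W, M i j = 0 := fun i hi j hj => hT.zero i hi j (hW hj)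
      have k := card_sdiff_add_card_eq_card (nbr_subset (M := tr M) (B := A \ X) (W := W))
      have h1 := h.card_lt (X ∪ ((A \ X) \ nbr (tr M) (A \ X) W))
        (union_subset hT.rows (sdiff_subset.trans sdiff_subset)) W (hW.trans hT.cols)
        (hT.rows_ne.mono subset_union_left) hWn (by
          intro i hi j hj
          rcases mem_union.1 hi with hi | hi
          · exact hWX i hi j hj
          · obtain ⟨hi1, hi2⟩ := mem_sdiff.1 hi
            by_contra hne
            exact hi2 (mem_nbr.2 ⟨hi1, j, hj, hne⟩))
      rw [card_union_of_disjoint (disjoint_of_subset_right sdiff_subset disjoint_sdiff)] at h1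
      omega)
  rw [Finset.sdiff_sdiff_eq_self hT.rows] at hG
  have hcard : (insert c X).card = X.card + 1 := card_insert_of_notMem hcX
  have hbr : Brace (insert c X) (B \ Y) M' := by
    intro P hP L hL hPn hLn hPL
    have hLB : L ⊆ B := hL.trans sdiff_subset
    have hLY : Disjoint L Y := disjoint_of_subset_left hL sdiff_disjoint
    have hLpos := card_pos.2 hLn
    have hPpos := card_pos.2 hPn
    rw [hcard]
    by_contra hlt
    by_cases hcP : c ∈ P
    · have hP' : P.erase c ⊆ X := by
        intro i hi
        exact (mem_insert.1 (hP (mem_of_mem_erase hi))).resolve_left (mem_erase.1 hi).1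
      have hdisj : Disjoint (A \ X) (P.erase c) := disjoint_of_subset_right hP' sdiff_disjoint
      have hsub := union_subset (sdiff_subset (s := A) (t := X)) (hP'.trans hT.rows)
      have hne : ((A \ X) ∪ P.erase c).Nonempty := ⟨c, mem_union_left _ hc⟩
      have hz : ∀ i ∈ (A \ X) ∪ P.erase c, ∀ j ∈ L, M i j = 0 := by
        intro i hi j hj
        rcases mem_union.1 hi with hi | hi
        · by_contra hne
          exact ((hM2 j).2 ⟨i, hi, hne⟩) (hPL c hcP j hj)
        · rw [← hM1 i j (mem_erase.1 hi).1]
          exact hPL i (mem_of_mem_erase hi) j hj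
      have h1 := h.card_lt _ hsub L hLB hne hLn hz
      have k := card_union_of_disjoint hdisj
      have := card_erase_add_one hcP
      have := (hmin _ _ ⟨hsub, hLB, hne, hLn, hz, by omega⟩).2
      omega
    · have hP' : P ⊆ X := by
        intro i hi
        refine (mem_insert.1 (hP hi)).resolve_left ?_
        rintro rfl; exact hcP hi
      have hcU := card_union_of_disjoint hLY
      have hz : ∀ i ∈ P, ∀ j ∈ L ∪ Y, M i j = 0 := by
        intro i hi j hj
        rcases mem_union.1 hj with hj | hj
        · rw [← hM1 i j (by rintro rfl; exact hcP hi)]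
          exact hPL i hi j hj
        · exact hT.zero i (hP' hi) j hj
      have hne : (L ∪ Y).Nonempty := hLn.mono subset_union_left
      have hsub := union_subset hLB hT.cols
      have h1 := h.card_lt P (hP'.trans hT.rows) _ hsub hPn hne hz
      have := (hmin _ _ ⟨hP'.trans hT.rows, hsub, hPn, hne, hz, by omega⟩).1
      omega
  have key := ec_le_of_brace _ _ (B \ Y) M' (Nat.lt_succ_self _) (by omega) (by omega) hG hbr
  rw [ec_insert_left _ hcX] at key
  have e1 : 4 * X.card ≤ ec M' X (B \ Y) := by
    rw [ec_eq_sum, mul_comm, ← smul_eq_mul]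
    refine card_nsmul_le_sum _ _ _ fun i hi => (hdeg i (hT.rows hi)).trans ?_
    have : nbr M B {i} ⊆ nbr M' (B \ Y) {i} := by
      intro j hj
      obtain ⟨hjB, i', hi', hij⟩ := mem_nbr.1 hj
      rw [mem_singleton] at hi'; subst hi'
      refine mem_nbr.2 ⟨mem_sdiff.2 ⟨hjB, fun hjY => hij (hT.zero i' hi j hjY)⟩, i', by simp, ?_⟩
      rwa [hM1 i' j (by rintro rfl; exact hcX hi)]
    refine (card_le_card this).trans (le_of_eq ?_)
    rw [nbr, card_filter]; simp
  have e2 : 0 < (nbr M' (B \ Y) {c}).card := by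
    by_contra h0
    have h1 := h.card_lt (A \ X) sdiff_subset (B \ Y) sdiff_subset ⟨c, hc⟩ (card_pos.1 (by omega))
      (by
        intro i hi j hj
        by_contra hne
        exact h0 (card_pos.2 ⟨j, mem_nbr.2 ⟨hj, c, by simp, (hM2 j).2 ⟨i, hi, hne⟩⟩⟩))
    omega
  omega

lemma Elementary.false_of_degrees {A B : Finset V} {M : V → V → ℝ} (h : Elementary A B M)
    (hA : A.Nonempty) (hrow : ∀ i ∈ A, 4 ≤ (nbr M B {i}).card)
    (hcol : ∀ j ∈ B, 4 ≤ (nbr (tr M) A {j}).card) : False := by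
  have hAB := h.card_eq
  by_cases hbr : Brace A B M
  · obtain ⟨i, hi⟩ := hA
    have h1 := hrow i hi
    have h2 := card_le_card (nbr_subset (M := M) (B := B) (W := {i}))
    have key := ec_le_of_brace _ A B M (Nat.lt_succ_self _) (by omega) hAB h.good hbr
    have e1 : 4 * A.card ≤ ec M A B := by
      rw [ec_eq_sum, mul_comm, ← smul_eq_mul]
      refine card_nsmul_le_sum _ _ _ fun i hi => (hrow i hi).trans (le_of_eq ?_)
      rw [nbr, card_filter]; simp
    omega
  · have hex : ∃ X Y, Tight A B M X Y := by
      simp only [Brace] at hbr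
      push Not at hbr
      obtain ⟨X, hX, Y, hY, hXn, hYn, hz, hlt⟩ := hbr
      have := h.card_lt X hX Y hY hXn hYn hz
      exact ⟨X, Y, hX, hY, hXn, hYn, hz, by omega⟩
    obtain ⟨X₀, Y₀, hT₀⟩ := hex
    have hmem : ∀ {X Y}, (X, Y) ∈ (A.powerset ×ˢ B.powerset).filter
        (fun p => Tight A B M p.1 p.2) ↔ Tight A B M X Y := by
      intro X Y
      simp only [mem_filter, mem_product, mem_powerset, and_iff_right_iff_imp]
      exact fun h => ⟨h.rows, h.cols⟩
    obtain ⟨⟨X, Y⟩, hXY, hmin⟩ := exists_min_image _ (fun p : Finset V × Finset V =>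
      min p.1.card p.2.card) ⟨(X₀, Y₀), hmem.2 hT₀⟩
    have hT := hmem.1 hXY
    have hmin' : ∀ X' Y', Tight A B M X' Y' → min X.card Y.card ≤ min X'.card Y'.card :=
      fun X' Y' h' => hmin (X', Y') (hmem.2 h')
    rcases le_total X.card Y.card with hle | hle
    · refine h.false_of_minimal_tight hrow hT fun X' Y' h' => ?_
      have := hmin' X' Y' h'
      omega
    · refine h.transpose.false_of_minimal_tight hcol (hT.transpose hAB) fun Y' X' h' => ?_
      have := hmin' X' Y' (h'.transpose hAB.symm)
      omega

/-- A regular sign-nonsingular graph has degree at most three. -/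
theorem Good.false_of_regular [Fintype V] [Nonempty V] {M : V → V → ℝ}
    (hG : Good univ univ M) {k : ℕ} (hk : 4 ≤ k) (hrow : ∀ i, (nbr M univ {i}).card = k)
    (hcol : ∀ j, (nbr (tr M) univ {j}).card = k) : False := by
  have hdegsum : ∀ X : Finset V, ∀ M : V → V → ℝ, (∀ i, (nbr M univ {i}).card = k) →
      ec M X univ = X.card * k := by
    intro X M hrow
    rw [ec_eq_sum, ← smul_eq_mul, ← sum_const]
    refine sum_congr rfl fun i _ => ?_
    rw [← hrow i, nbr, card_filter]; simp
  have hsupp : ∀ X : Finset V, ec M X univ = ec M X (nbr M univ X) := by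
    intro X
    conv_lhs => rw [← union_compl (nbr M univ X)]
    rw [ec_union_right _ disjoint_compl_right, ec_eq_zero (Y := (nbr M univ X)ᶜ), add_zero]
    intro i hi j hj
    by_contra hne
    exact (mem_compl.1 hj) (mem_nbr.2 ⟨mem_univ _, i, hi, hne⟩)
  have hsplit : ∀ X Y : Finset V, ec M univ Y = ec M X Y + ec M Xᶜ Y := by
    intro X Y
    rw [← ec_union_left _ disjoint_compl_right, union_compl]
  have hcount : ∀ X : Finset V, (nbr M univ X).card * k
      = X.card * k + ec M Xᶜ (nbr M univ X) := by
    intro X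
    rw [← hdegsum X M hrow, hsupp, ← hsplit, ← hdegsum _ (tr M) hcol, ec_tr]
  have hle : ∀ X : Finset V, X.card ≤ (nbr M univ X).card := fun X =>
    Nat.le_of_mul_le_mul_right (by rw [hcount]; omega) (show 0 < k by omega)
  -- By regularity such a set has exactly as many neighbours as elements, and no other row meets
  -- them; minimality makes the resulting block elementary.
  obtain ⟨A, hA, hmin⟩ := exists_min_image (univ.filter fun X : Finset V =>
    X.Nonempty ∧ (nbr M univ X).card ≤ X.card) card
    ⟨univ, mem_filter.2 ⟨mem_univ _, univ_nonempty, card_le_univ _⟩⟩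
  obtain ⟨-, hAn, hAle⟩ := mem_filter.1 hA
  set B := nbr M univ A with hB
  have hAB : A.card = B.card := le_antisymm (hle A) hAle
  have hrest : ∀ i, i ∉ A → ∀ j ∈ B, M i j = 0 := by
    have h0 : ec M Aᶜ B = 0 := by
      have := hcount A
      rw [← hB, ← hAB] at this
      omega
    intro i hi j hj
    by_contra hne
    rw [ec, card_eq_zero] at h0
    have : (i, j) ∈ (∅ : Finset (V × V)) := by
      rw [← h0]
      exact mem_filter.2 ⟨mem_product.2 ⟨mem_compl.2 hi, hj⟩, hne⟩
    simp at this
  have hAout : ∀ i ∈ A, ∀ j, M i j ≠ 0 → j ∈ B := fun i hi j hij =>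
    mem_nbr.2 ⟨mem_univ _, i, hi, hij⟩
  have hgood : Good A B M := by
    intro w hw hPM x hx
    have hrestPM : PM Aᶜ Bᶜ M := by
      apply PM_of_hall
      intro W hW _
      refine (hle W).trans (card_le_card ?_)
      intro j hj
      obtain ⟨-, i, hi, hij⟩ := mem_nbr.1 hj
      exact mem_nbr.2 ⟨mem_compl.2 fun hjB => hij (hrest i (mem_compl.1 (hW hi)) j hjB), i, hi, hij⟩
    let w' : V → V → ℝ := fun i j => if i ∈ A then w i j else 1
    have hPM' : PM univ univ (fun i j => w' i j * M i j) := by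
      have h1 : PM A B (fun i j => w' i j * M i j) := hPM.congr fun i hi j _ hij => by
        simpa [w', hi] using hij
      have h2 : PM Aᶜ Bᶜ (fun i j => w' i j * M i j) := hrestPM.congr fun i hi j _ hij => by
        simpa [w', mem_compl.1 hi] using hij
      have := h1.union h2 disjoint_compl_right
      rwa [union_compl, union_compl] at this
    have h3 := hG w' (fun i j => by simp only [w']; split_ifs <;> simp [hw]) hPM'
      (fun j => if j ∈ B then x j else 0) (by
        intro i _
        by_cases hi : i ∈ A
        · rw [← sum_subset (subset_univ B)]
          · refine Eq.trans ?_ (hx i hi)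
            exact sum_congr rfl fun j hj => by simp [w', hi, hj]
          · intro j _ hj; simp [hj]
        · refine sum_eq_zero fun j _ => ?_
          by_cases hj : j ∈ B
          · simp [hrest i hi j hj]
          · simp [hj])
    intro j hj
    simpa [hj] using h3 j (mem_univ _)
  have hel : Elementary A B M := by
    refine ⟨hgood, hAB, fun P hP L hL hPn hLn hPL => ?_⟩
    have hdisj : nbr M univ P ⊆ B \ L := by
      intro j hj
      obtain ⟨-, i, hi, hij⟩ := mem_nbr.1 hj
      exact mem_sdiff.2 ⟨hAout i (hP hi) j hij, fun hjL => hij (hPL i hi j hjL)⟩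
    have h1 := card_le_card hdisj
    rw [card_sdiff_of_subset hL] at h1
    have h2 := card_le_card hL
    have h3 := card_pos.2 hLn
    by_contra hlt
    have h4 := hmin P (mem_filter.2 ⟨mem_univ _, hPn, by omega⟩)
    have h5 : P = A := eq_of_subset_of_card_le hP h4
    obtain ⟨j, hj⟩ := hLn
    obtain ⟨-, i, hi, hij⟩ := mem_nbr.1 (hL hj)
    exact hij (hPL i (h5 ▸ hi) j hj)
  refine hel.false_of_degrees hAn (fun i hi => ?_) (fun j hj => ?_)
  · refine (hk.trans (hrow i).ge).trans (card_le_card ?_)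
    intro j hj
    obtain ⟨-, i', hi', hij⟩ := mem_nbr.1 hj
    rw [mem_singleton] at hi'; subst hi'
    exact mem_nbr.2 ⟨hAout i' hi j hij, i', by simp, hij⟩
  · refine (hk.trans (hcol j).ge).trans (card_le_card ?_)
    intro i hi
    obtain ⟨-, j', hj', hij⟩ := mem_nbr.1 hi
    rw [mem_singleton] at hj'; subst hj'
    refine mem_nbr.2 ⟨?_, j', by simp, hij⟩
    by_contra hiA
    exact hij (hrest i hiA j' hj)

/-! ### Determinants without cancellation and two-colourings. -/

/-- A nonnegative matrix all of whose nonzero diagonals have the same sign is sign-nonsingular. -/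
lemma good_of_sign_eq [Fintype V] {M : V → V → ℝ} (hM : ∀ i j, 0 ≤ M i j)
    (h : ∀ σ τ : Equiv.Perm V, (∀ v, M v (σ v) ≠ 0) → (∀ v, M v (τ v) ≠ 0) →
      Equiv.Perm.sign σ = Equiv.Perm.sign τ) : Good univ univ M := by
  intro w hw ⟨f, hf, hf'⟩ x hx
  let W : Matrix V V ℝ := fun i j => w i j * M i j
  have hfb : Function.Bijective f := Finite.injective_iff_bijective.1 (by simpa using hf)
  let τ : Equiv.Perm V := Equiv.ofBijective f hfb
  have hτ : ∀ v, w v (τ v) * M v (τ v) ≠ 0 := fun v => (hf' v (mem_univ _)).2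
  have hterm : ∀ σ : Equiv.Perm V, Equiv.Perm.sign σ • ∏ i, W.transpose (σ i) i
      = Equiv.Perm.sign τ • ∏ i, W.transpose (σ i) i := by
    intro σ
    by_cases h0 : ∏ i, W.transpose (σ i) i = 0
    · rw [h0, smul_zero, smul_zero]
    · have h1 : ∀ v, w v (σ v) * M v (σ v) ≠ 0 := fun v => prod_ne_zero_iff.1 h0 v (mem_univ _)
      rw [h σ τ (fun v => right_ne_zero_of_mul (h1 v))
        (fun v => right_ne_zero_of_mul (hτ v))]
  have hdet : W.det ≠ 0 := by
    rw [← Matrix.det_transpose, Matrix.det_apply, sum_congr rfl fun σ _ => hterm σ, ← smul_sum]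
    rw [smul_ne_zero_iff_ne]
    have hpos : 0 < ∏ i, W.transpose (τ i) i :=
      prod_pos fun i _ => lt_of_le_of_ne (mul_nonneg (hw _ _) (hM _ _)) (hτ i).symm
    have hnn : ∀ σ ∈ (univ : Finset (Equiv.Perm V)), 0 ≤ ∏ i, W.transpose (σ i) i :=
      fun σ _ => prod_nonneg fun i _ => mul_nonneg (hw _ _) (hM _ _)
    exact (sum_pos' hnn ⟨τ, mem_univ _, hpos⟩).ne'
  have hker : W.mulVec x = 0 := by
    ext i
    exact hx i (mem_univ _)
  have := Matrix.eq_zero_of_mulVec_eq_zero hdet hker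
  intro j _
  exact congrFun this j

/-- A nonnegative sign-nonsingular graph with a perfect matching has no two-colouring of its
columns in which every row meets both colours. -/
lemma Good.false_of_bichromatic [Fintype V] [Nonempty V] {M : V → V → ℝ}
    (hG : Good univ univ M) (hM : ∀ i j, 0 ≤ M i j) (hPM : PM univ univ M) (S : Finset V)
    (h1 : ∀ i, ∃ j ∈ S, M i j ≠ 0) (h2 : ∀ i, ∃ j, j ∉ S ∧ M i j ≠ 0) : False := by
  let p : V → ℝ := fun i => ∑ j ∈ S, M i j
  let n : V → ℝ := fun i => ∑ j ∈ Sᶜ, M i j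
  have hp : ∀ i, 0 < p i := fun i => by
    obtain ⟨j, hj, hij⟩ := h1 i
    exact sum_pos' (fun j _ => hM i j) ⟨j, hj, lt_of_le_of_ne (hM i j) hij.symm⟩
  have hn : ∀ i, 0 < n i := fun i => by
    obtain ⟨j, hj, hij⟩ := h2 i
    exact sum_pos' (fun j _ => hM i j) ⟨j, mem_compl.2 hj, lt_of_le_of_ne (hM i j) hij.symm⟩
  -- The crossed weights make row `i` contribute `n i * p i - p i * n i` against the vector of
  -- signs.
  have key := hG (fun i j => if j ∈ S then n i else p i)
    (fun i j => by split_ifs; exacts [(hn i).le, (hp i).le])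
    (hPM.congr fun i _ j _ hij => by
      refine mul_ne_zero ?_ hij
      split_ifs; exacts [(hn i).ne', (hp i).ne'])
    (fun j => if j ∈ S then 1 else -1) (by
      intro i _
      rw [← sum_add_sum_compl S]
      have e1 : ∑ j ∈ S, (if j ∈ S then n i else p i) * M i j * (if j ∈ S then 1 else -1)
          = n i * p i := by
        rw [mul_sum]
        exact sum_congr rfl fun j hj => by simp [hj]
      have e2 : ∑ j ∈ Sᶜ, (if j ∈ S then n i else p i) * M i j * (if j ∈ S then 1 else -1)
          = -(p i * n i) := by
        rw [mul_sum, ← sum_neg_distrib]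
        exact sum_congr rfl fun j hj => by simp [mem_compl.1 hj]
      rw [e1, e2]; ring)
  obtain ⟨v⟩ := ‹Nonempty V›
  have := key v (mem_univ _)
  split_ifs at this <;> norm_num at this

/-- If all the sets `N i` are large, some two-colouring makes every `N i` bichromatic. -/
lemma exists_bichromatic [Fintype V] [Nonempty V] (N : V → Finset V) {d : ℕ}
    (hd : ∀ i, d + 2 ≤ (N i).card) (hn : Fintype.card V < 2 ^ (d + 1)) :
    ∃ S : Finset V, ∀ i, (∃ j ∈ S, j ∈ N i) ∧ ∃ j, j ∉ S ∧ j ∈ N i := by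
  by_contra! hc
  set n := Fintype.card V with hncard
  -- A colouring fails at `i` only if `S` contains or avoids `N i`. This excludes at most `2 * 2 ^
  -- (n - (d + 2))` sets for each `i`, too few in total to exhaust all `2 ^ n`.
  have hcover : (univ : Finset (Finset V)) ⊆ univ.biUnion fun i : V =>
      Icc (N i) univ ∪ Icc ∅ (N i)ᶜ := by
    intro S _
    obtain ⟨i, hi⟩ := hc S
    refine mem_biUnion.2 ⟨i, mem_univ _, ?_⟩
    by_cases h : ∃ j ∈ S, j ∈ N i
    · refine mem_union_left _ (mem_Icc.2 ⟨fun j hj => ?_, subset_univ _⟩)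
      by_contra hjS
      exact hi h j hjS hj
    · push Not at h
      exact mem_union_right _ (mem_Icc.2 ⟨empty_subset _, fun j hj => mem_compl.2 (h j hj)⟩)
  have h1 := (card_le_card hcover).trans card_biUnion_le
  have hN : ∀ i, (N i).card ≤ n := fun i => card_le_univ _
  have h2 : ∀ i ∈ (univ : Finset V), (Icc (N i) univ ∪ Icc ∅ (N i)ᶜ).card
      ≤ 2 * 2 ^ (n - (d + 2)) := by
    intro i _
    refine (card_union_le _ _).trans ?_
    rw [card_Icc_finset (subset_univ _), card_Icc_finset (empty_subset _), card_compl, card_empty,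
      card_univ, ← hncard, tsub_zero, ← two_mul]
    exact Nat.mul_le_mul_left 2 (Nat.pow_le_pow_right (by norm_num) (Nat.sub_le_sub_left (hd i) n))
  have h3 := h1.trans (sum_le_card_nsmul _ _ _ h2)
  rw [card_univ, Fintype.card_finset, card_univ, smul_eq_mul, ← hncard] at h3
  obtain ⟨v⟩ := ‹Nonempty V›
  have h4 := (hd v).trans (hN v)
  have h5 : 2 * 2 ^ (n - (d + 2)) * 2 ^ (d + 1) = 2 ^ n := by
    have : n = 1 + (n - (d + 2)) + (d + 1) := by omega
    conv_rhs => rw [this, pow_add, pow_add, pow_one]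
  rw [← h5, mul_comm n] at h3
  have := Nat.le_of_mul_le_mul_left h3 (by positivity)
  omega

end SignedBip

/-! ### Directed 2-factors as permutations. -/

namespace Digraph

open scoped Classical

variable {V : Type*}

/-- The digraph with the arcs `v → σ v`. -/
def ofPerm (σ : Equiv.Perm V) : Digraph V := ⟨fun u v => σ u = v⟩

lemma isTwoFactor_ofPerm {D : Digraph V} {σ : Equiv.Perm V} (h : ∀ v, D.Adj v (σ v)) :
    D.IsTwoFactor (ofPerm σ) := by
  refine ⟨fun u v huv => ?_, fun v => ⟨?_, ?_⟩⟩
  · change σ u = v at huv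
    rw [← huv]; exact h u
  · rw [outDeg, Set.ncard_eq_one]
    refine ⟨σ v, ?_⟩
    ext w
    simp only [ofPerm, Set.mem_ofPred_eq, Set.mem_singleton_iff]
    exact eq_comm
  · rw [inDeg, Set.ncard_eq_one]
    refine ⟨σ.symm v, ?_⟩
    ext w
    simp only [ofPerm, Set.mem_ofPred_eq, Set.mem_singleton_iff]
    exact (Equiv.eq_symm_apply σ).symm

lemma IsTwoFactor.exists_perm [Fintype V] {D F : Digraph V} (h : D.IsTwoFactor F) :
    ∃ σ : Equiv.Perm V, ∀ v, D.Adj v (σ v) := by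
  have hout : ∀ v, ∃ w, F.Adj v w := by
    intro v
    obtain ⟨w, hw⟩ := Set.ncard_eq_one.1 (h.2 v).1
    exact ⟨w, (hw ▸ Set.mem_singleton w : w ∈ {w : V | F.Adj v w})⟩
  choose f hf using hout
  have hinj : Function.Injective f := by
    intro a b hab
    obtain ⟨w, hw⟩ := Set.ncard_eq_one.1 (h.2 (f a)).2
    have ha : a ∈ {u : V | F.Adj u (f a)} := hf a
    have hb : b ∈ {u : V | F.Adj u (f a)} := by rw [hab]; exact hf b
    rw [hw] at ha hb
    exact ha.trans hb.symm
  exact ⟨Equiv.ofBijective f (Finite.injective_iff_bijective.1 hinj), fun v => h.1 (hf v)⟩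

/-- Components are orbits of `σ`. Without fixed points every orbit is the support of a nontrivial
cycle factor, and these are what `cycleType` lists. -/
lemma numCycles_ofPerm [Fintype V] {σ : Equiv.Perm V} (hσ : ∀ v, σ v ≠ v) :
    (ofPerm σ).numCycles = Multiset.card σ.cycleType := by
  have hmem : ∀ v, σ.cycleOf v ∈ σ.cycleFactorsFinset := fun v =>
    Equiv.Perm.cycleOf_mem_cycleFactorsFinset_iff.2 (Equiv.Perm.mem_support.2 (hσ v))
  let g : (ofPerm σ).Component → σ.cycleFactorsFinset :=
    Quot.lift (fun v => ⟨σ.cycleOf v, hmem v⟩) (by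
      intro u v huv
      change σ u = v at huv
      subst huv
      ext1
      exact (Equiv.Perm.sameCycle_apply_right.2 (Equiv.Perm.SameCycle.refl σ u)).cycleOf_eq)
  have hg : Function.Bijective g := by
    constructor
    · rintro ⟨x⟩ ⟨y⟩ hxy
      have h1 : σ.cycleOf x = σ.cycleOf y := congrArg Subtype.val hxy
      have h2 : σ.SameCycle x y := (Equiv.Perm.sameCycle_iff_cycleOf_eq_of_mem_support
        (Equiv.Perm.mem_support.2 (hσ x)) (Equiv.Perm.mem_support.2 (hσ y))).2 h1
      obtain ⟨n, -, hn⟩ := h2.exists_pow_eq'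
      rw [← hn]
      clear hn hxy h1 h2
      induction n with
      | zero => rfl
      | succ n ih =>
        refine ih.trans (Quot.sound ?_)
        change σ ((σ ^ n) x) = (σ ^ (n + 1)) x
        rw [pow_succ', Equiv.Perm.mul_apply]
    · rintro ⟨c, hc⟩
      obtain ⟨x, hx⟩ := (Equiv.Perm.mem_cycleFactorsFinset_iff.1 hc).1.nonempty_support
      refine ⟨Quot.mk _ x, ?_⟩
      ext1
      exact (Equiv.Perm.cycle_is_cycleOf hx hc).symm
  rw [numCycles, Nat.card_congr (Equiv.ofBijective g hg), Nat.card_eq_fintype_card,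
    Fintype.card_coe, Equiv.Perm.cycleType_def, Multiset.card_map]
  rfl

lemma sign_eq_of_numCycles [Fintype V] {σ : Equiv.Perm V} (hσ : ∀ v, σ v ≠ v) :
    Equiv.Perm.sign σ = (-1) ^ (Fintype.card V + (ofPerm σ).numCycles) := by
  rw [Equiv.Perm.sign_of_cycleType, numCycles_ofPerm hσ, Equiv.Perm.sum_cycleType]
  congr 2
  rw [← Finset.card_univ]
  congr 1
  ext v
  simp [hσ v]

/-- Modulo two, the number of cycles is determined by the number of even ones. -/
lemma numCycles_add_card [Fintype V] (F : Digraph V) :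
    F.numCycles + Fintype.card V ≡ F.numCyclesMod 0 + F.numCyclesMod 1 [MOD 2] := by
  have hfin : Finite F.Component := Finite.of_surjective _ Quot.mk_surjective
  let _ : Fintype F.Component := Fintype.ofFinite _
  have hsum : Fintype.card V = ∑ C : F.Component, F.componentSize C := by
    rw [← Finset.card_univ, Finset.card_eq_sum_card_fiberwise (f := Quot.mk F.Adj)
      (t := Finset.univ) (fun _ _ => Finset.mem_coe.2 (Finset.mem_univ _))]
    refine Finset.sum_congr rfl fun C _ => ?_
    rw [componentSize, Set.ncard_eq_toFinset_card']
    congr 1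
    ext v; simp
  have hmod : ∀ i, F.numCyclesMod i
      = ∑ C : F.Component, if F.componentSize C ≡ 2 * i [MOD 4] then 1 else 0 := by
    intro i
    rw [numCyclesMod, Set.ncard_eq_toFinset_card', ← Finset.card_filter]
    congr 1
    ext C; simp
  have hnum : F.numCycles = ∑ C : F.Component, 1 := by
    rw [numCycles, Nat.card_eq_fintype_card]; simp
  -- The sum `1 + s` is odd exactly when `s` is `0` or `2` modulo `4`.
  have hpt : ∀ C : F.Component, ∃ k, 1 + F.componentSize C
      = (if F.componentSize C ≡ 2 * 0 [MOD 4] then 1 else 0)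
        + (if F.componentSize C ≡ 2 * 1 [MOD 4] then 1 else 0) + 2 * k := by
    intro C
    generalize F.componentSize C = s
    have hs : s % 4 = 0 ∨ s % 4 = 1 ∨ s % 4 = 2 ∨ s % 4 = 3 := by omega
    refine ⟨s / 4 * 2 + if s % 4 = 0 ∨ s % 4 = 2 then s % 4 / 2 else (s % 4 + 1) / 2, ?_⟩
    rcases hs with hs | hs | hs | hs <;> simp [Nat.ModEq, hs] <;> omega
  choose k hk using hpt
  have : F.numCycles + Fintype.card V
      = F.numCyclesMod 0 + F.numCyclesMod 1 + 2 * ∑ C, k C := by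
    rw [hnum, hsum, hmod, hmod, Finset.mul_sum, ← Finset.sum_add_distrib,
      ← Finset.sum_add_distrib, ← Finset.sum_add_distrib]
    exact Finset.sum_congr rfl fun C _ => hk C
  rw [this, Nat.ModEq]
  omega

lemma IsStronglyPseudoTwoFactorIsomorphic.isPseudo [Fintype V] {D : Digraph V}
    (h : D.IsStronglyPseudoTwoFactorIsomorphic) : D.IsPseudoTwoFactorIsomorphic := by
  refine ⟨h.1, fun F F' hF hF' => ?_⟩
  have h1 := F.numCycles_add_card
  have h2 := F'.numCycles_add_card
  obtain ⟨h3, h4⟩ := h.2 F F' hF hF'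
  exact Nat.ModEq.add_right_cancel' (Fintype.card V) (h1.trans ((h3.add h4).trans h2.symm))

/-- The adjacency matrix. -/
noncomputable def adjMat (D : Digraph V) : V → V → ℝ := fun i j => if D.Adj i j then 1 else 0

lemma adjMat_ne_zero {D : Digraph V} {i j : V} : D.adjMat i j ≠ 0 ↔ D.Adj i j := by
  simp [adjMat]

lemma adjMat_nonneg (D : Digraph V) (i j : V) : 0 ≤ D.adjMat i j := by
  rw [adjMat]; split_ifs <;> norm_num

lemma IsPseudoTwoFactorIsomorphic.good [Fintype V] {D : Digraph V}
    (h : D.IsPseudoTwoFactorIsomorphic) (hD : ∀ v, ¬ D.Adj v v) :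
    SignedBip.Good Finset.univ Finset.univ D.adjMat := by
  refine SignedBip.good_of_sign_eq D.adjMat_nonneg fun σ τ hσ hτ => ?_
  simp only [adjMat_ne_zero] at hσ hτ
  have hne : ∀ σ : Equiv.Perm V, (∀ v, D.Adj v (σ v)) → ∀ v, σ v ≠ v := by
    intro σ hσ v hv
    exact hD v (by simpa [hv] using hσ v)
  rw [sign_eq_of_numCycles (hne σ hσ), sign_eq_of_numCycles (hne τ hτ), pow_add, pow_add,
    Int.units_pow_eq_pow_mod_two _ (ofPerm σ).numCycles,
    Int.units_pow_eq_pow_mod_two _ (ofPerm τ).numCycles,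
    h.2 _ _ (isTwoFactor_ofPerm hσ) (isTwoFactor_ofPerm hτ)]

lemma card_nbr_adjMat [Fintype V] (D : Digraph V) (v : V) :
    (SignedBip.nbr D.adjMat Finset.univ {v}).card = D.outDeg v := by
  rw [outDeg, Set.ncard_eq_toFinset_card']
  congr 1
  ext w
  simp [SignedBip.mem_nbr, adjMat_ne_zero]

lemma card_nbr_tr_adjMat [Fintype V] (D : Digraph V) (v : V) :
    (SignedBip.nbr (SignedBip.tr D.adjMat) Finset.univ {v}).card = D.inDeg v := by
  rw [inDeg, Set.ncard_eq_toFinset_card']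
  congr 1
  ext w
  simp [SignedBip.mem_nbr, SignedBip.tr, adjMat_ne_zero]

lemma IsPseudoTwoFactorIsomorphic.not_isDiregular [Fintype V] [Nonempty V] {D : Digraph V}
    (h : D.IsPseudoTwoFactorIsomorphic) (hD : ∀ v, ¬ D.Adj v v) {k : ℕ} (hk : 4 ≤ k) :
    ¬ D.IsDiregular k := fun hreg =>
  (h.good hD).false_of_regular hk (fun i => (D.card_nbr_adjMat i).trans (hreg i).1)
    fun j => (D.card_nbr_tr_adjMat j).trans (hreg j).2

lemma IsPseudoTwoFactorIsomorphic.exists_outDeg_le [Fintype V] [Nonempty V] {D : Digraph V}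
    (h : D.IsPseudoTwoFactorIsomorphic) (hD : ∀ v, ¬ D.Adj v v) :
    ∃ v : V, D.outDeg v ≤ ⌊Real.logb 2 (Fintype.card V : ℝ)⌋₊ + 1 := by
  by_contra! hc
  set d := ⌊Real.logb 2 (Fintype.card V : ℝ)⌋₊ with hd
  -- The negated conclusion gives out-degrees at least `d + 2`, which matches this power in
  -- `exists_bichromatic`.
  have hn : Fintype.card V < 2 ^ (d + 1) := by
    have h1 : Real.logb 2 (Fintype.card V : ℝ) < (d + 1 : ℕ) := by
      push_cast
      exact Nat.lt_floor_add_one _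
    have h2 := (Real.logb_lt_iff_lt_rpow (by norm_num)
      (by exact_mod_cast Fintype.card_pos)).1 h1
    rw [Real.rpow_natCast] at h2
    exact_mod_cast h2
  obtain ⟨S, hS⟩ := SignedBip.exists_bichromatic
    (fun v => SignedBip.nbr D.adjMat Finset.univ {v}) (d := d)
    (fun v => by rw [card_nbr_adjMat]; exact hc v) hn
  simp only [SignedBip.mem_nbr, Finset.mem_univ, true_and, Finset.mem_singleton,
    exists_eq_left] at hS
  obtain ⟨F, hF⟩ := h.1
  obtain ⟨σ, hσ⟩ := hF.exists_perm
  exact (h.good hD).false_of_bichromatic D.adjMat_nonneg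
    ⟨σ, σ.injective.injOn, fun i _ => ⟨Finset.mem_univ _, adjMat_ne_zero.2 (hσ i)⟩⟩ S
    (fun i => (hS i).1) fun i => (hS i).2

end Digraph

theorem mainTheorem4 {V : Type*} [Fintype V] [Nonempty V] (D : Digraph V)
    (hD : ∀ v : V, ¬ D.Adj v v) :
    (∀ k : ℕ, 4 ≤ k → D.IsDiregular k →
      ¬ D.IsPseudoTwoFactorIsomorphic ∧ ¬ D.IsStronglyPseudoTwoFactorIsomorphic) ∧
    (D.IsPseudoTwoFactorIsomorphic →
      ∃ v : V, D.outDeg v ≤ ⌊Real.logb 2 (Fintype.card V : ℝ)⌋₊ + 1) :=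
  ⟨fun _ hk hreg => ⟨fun h => h.not_isDiregular hD hk hreg,
    fun h => h.isPseudo.not_isDiregular hD hk hreg⟩, fun h => h.exists_outDeg_le hD⟩
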